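/- Let $G=(V,E)$ be a finite triconnected graph (at least four vertices, and connected after the deletion of any at most two vertices), and let $\Gamma$ be a planar straight-line drawing of $G$ with vertex positions $\gamma_i\in\mathbb{R}^2$, such that the vertices lying on the boundary of the convex hull of $\{\gamma_i : i\in V\}$ are exactly the vertices of the outer face. A vertex is external if it lies on the outer face and internal otherwise; an edge or a face is internal if it is incident to an internal vertex; a face is strictly internal if all vertices incident to it are internal. $N(i)$ denotes the set of neighbours of $i$. Call $\Gamma$ a weighted barycenter drawing if there are positive weights $w_{ij}=w_{ji}$ on the internal edges such that, for each internal vertex $i$, $$\gamma_i=\frac{1}{\sum_{j\in N(i)}w_{ij}}\sum_{j\in N(i)}w_{ij}\gamma_j .$$ Consider positive (not necessarily symmetric) weights $z_{ij}$, for internal vertices $i$ and $j\in N(i)$, such that for each internal vertex $i$ $$\sum_{j\in N(i)}z_{ij}=1\quad\text{and}\quad \gamma_i=\sum_{j\in N(i)}z_{ij}\gamma_j, \qquad (1)$$ and, for a face with boundary cycle $C=(v_0,v_1,\dots,v_{k-1},v_k=v_0)$, the cycle equation $$\prod_{i=0}^{k-1}z_{v_i,v_{i+1}}=\prod_{i=1}^{k}z_{v_i,v_{i-1}}.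 \qquad (2)$$ Then: (a) $\Gamma$ is a weighted barycenter drawing if and only if there are positive $z_{ij}$ satisfying (1) such that (2) holds for every strictly internal face. (b) $\Gamma$ is a weighted barycenter drawing if and only if there are positive numbers $z_{ij}$ for all ordered pairs $(i,j)$ of adjacent vertices (unrestricted apart from positivity when $i$ is external) satisfying (1) at every internal vertex such that (2) holds for every internal face. -/

import Mathlib

namespace BaryDrawing

/-- A graph is triconnected if it has at least four vertices and stays connected whenever fewer
than three vertices are deleted. -/
def Triconnected {V : Type*} [Fintype V] (G : SimpleGraph V) : Prop :=
  4 ≤ Fintype.card V ∧ ∀ S : Finset V, S.card < 3 → (G.induce {v : V | v ∉ S}).Connected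

/-- `γ` places the vertices of `G` at points of the plane `ℂ` so that drawing each edge as a
straight segment gives a planar drawing: distinct vertices are at distinct points, no vertex
lies on an edge that it is not an end of, and two distinct edges meet at most in a common
end. -/
structure IsPlanarDrawing {V : Type*} (G : SimpleGraph V) (γ : V → ℂ) : Prop where
  injective : Function.Injective γ
  vertex_on_edge : ∀ i j k : V, G.Adj i j → γ k ∈ segment ℝ (γ i) (γ j) → k = i ∨ k = j
  edge_inter : ∀ i j k l : V, G.Adj i j → G.Adj k l → s(i, j) ≠ s(k, l) →
    ∀ p : ℂ, p ∈ segment ℝ (γ i) (γ j) → p ∈ segment ℝ (γ k) (γ l) →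
      ∃ v : V, v ∈ s(i, j) ∧ v ∈ s(k, l) ∧ p = γ v

/-- The set of points of the plane covered by the drawing. -/
def drawnSet {V : Type*} (G : SimpleGraph V) (γ : V → ℂ) : Set ℂ :=
  Set.range γ ∪ {p : ℂ | ∃ i j : V, G.Adj i j ∧ p ∈ segment ℝ (γ i) (γ j)}

/-- The faces of the drawing: the connected components of the complement of the drawing. -/
def IsFace {V : Type*} (G : SimpleGraph V) (γ : V → ℂ) (F : Set ℂ) : Prop :=
  ∃ p ∈ (drawnSet G γ)ᶜ, F = connectedComponentIn (drawnSet G γ)ᶜ p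

/-- The outer face is the unbounded one. -/
def IsOuterFace {V : Type*} (G : SimpleGraph V) (γ : V → ℂ) (F : Set ℂ) : Prop :=
  IsFace G γ F ∧ ¬ Bornology.IsBounded F

/-- The vertex `v` is incident to the face `F`. -/
def Incident {V : Type*} (γ : V → ℂ) (v : V) (F : Set ℂ) : Prop :=
  γ v ∈ frontier F

/-- A vertex is external if it is on the outer face. -/
def IsExternal {V : Type*} (G : SimpleGraph V) (γ : V → ℂ) (v : V) : Prop :=
  ∃ F : Set ℂ, IsOuterFace G γ F ∧ Incident γ v F

/-- A vertex is internal if it is not external. -/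
def IsInternal {V : Type*} (G : SimpleGraph V) (γ : V → ℂ) (v : V) : Prop :=
  ¬ IsExternal G γ v

/-- The vertices on (the boundary of) the convex hull of the drawing are exactly the vertices
of the outer face. -/
def HullIsOuterFace {V : Type*} (G : SimpleGraph V) (γ : V → ℂ) : Prop :=
  ∃ F : Set ℂ, IsOuterFace G γ F ∧
    ∀ v : V, Incident γ v F ↔ γ v ∈ frontier (convexHull ℝ (Set.range γ))

/-- An internal face is a face incident to some internal vertex. -/
def IsInternalFace {V : Type*} (G : SimpleGraph V) (γ : V → ℂ) (F : Set ℂ) : Prop :=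
  IsFace G γ F ∧ ∃ v : V, Incident γ v F ∧ IsInternal G γ v

/-- A strictly internal face is a face all of whose incident vertices are internal. -/
def IsStrictlyInternalFace {V : Type*} (G : SimpleGraph V) (γ : V → ℂ) (F : Set ℂ) : Prop :=
  IsFace G γ F ∧ ∀ v : V, Incident γ v F → IsInternal G γ v

/-- The closed walk `c = (v₀, v₁, …, vₖ = v₀)` is a facial cycle of the face `F`: it is a cycle of
the graph, and all its edges are drawn on the boundary of `F`.  (In a planar drawing of a
triconnected graph the boundary of a face is a single cycle, so `c` then is the whole boundary
of `F`, traversed once in one of its two directions.) -/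
def IsFacialCycle {V : Type*} {G : SimpleGraph V} (γ : V → ℂ) (F : Set ℂ) {v : V}
    (c : G.Walk v v) : Prop :=
  c.IsCycle ∧ ∀ d ∈ c.darts, segment ℝ (γ d.fst) (γ d.snd) ⊆ frontier F

/-- The cycle equation for a closed walk `c = (v₀, v₁, …, vₖ = v₀)`: the product of the
`z vᵢ vᵢ₊₁` equals the product of the `z vᵢ₊₁ vᵢ`, for `0 ≤ i < k`. -/
def CycleEquation {V : Type*} {G : SimpleGraph V} (z : V → V → ℝ) {v : V}
    (c : G.Walk v v) : Prop :=
  (c.darts.map fun d => z d.fst d.snd).prod = (c.darts.map fun d => z d.snd d.fst).prod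

open scoped Classical in
/-- The (symmetric, positive) weighted barycenter property: every internal edge has a positive
weight such that each internal vertex is the weighted barycenter of its neighbours. -/
def IsWeightedBarycenterDrawing {V : Type*} [Fintype V] (G : SimpleGraph V) (γ : V → ℂ) :
    Prop :=
  ∃ w : Sym2 V → ℝ,
    (∀ i j : V, G.Adj i j → IsInternal G γ i → 0 < w s(i, j)) ∧
    ∀ i : V, IsInternal G γ i →
      γ i = (∑ j ∈ G.neighborFinset i, w s(i, j))⁻¹ •
        ∑ j ∈ G.neighborFinset i, w s(i, j) • γ j

open scoped Classical in
/-- `z` gives, at each internal vertex `i`, positive weights on the edges out of `i` that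
express `γ i` as a convex combination of the positions of the neighbours of `i`. -/
def IsConvexWeights {V : Type*} [Fintype V] (G : SimpleGraph V) (γ : V → ℂ)
    (z : V → V → ℝ) : Prop :=
  ∀ i : V, IsInternal G γ i →
    (∀ j : V, G.Adj i j → 0 < z i j) ∧
    ∑ j ∈ G.neighborFinset i, z i j = 1 ∧
    γ i = ∑ j ∈ G.neighborFinset i, z i j • γ j

end BaryDrawing

/-! Given symmetric weights `w`, put `z i j = w s(i, j) / S i`, where `S i` is the sum of the
weights at `i`. Around any closed walk the numerators agree in both directions, and every vertex
starts as many darts as it ends, so the normalising factors cancel: the cycle equation holds for all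
closed walks, facial or not.

Conversely, symmetric weights amount to positive vertex scalars making `exp (φ i) * z i j`
symmetric, i.e. to a potential `φ` for the antisymmetric function `c i j = log (z i j) - log (z j
i)` on edges joining internal vertices. A potential exists once `c` sums to zero over every cycle of
internal vertices (`exists_potential`), while the hypothesis supplies this only for boundary cycles
of strictly internal faces.

The passage from faces to cycles uses winding numbers. The net number of times a closed walk
traverses an edge is the winding number on the left of the edge minus that on its right
(`IsPlanarDrawing.windingSum_sub`). Hence the sum of `c` along the walk is a combination of the sums
of `c` over face boundaries, with winding numbers as coefficients. A face touching an external
vertex has coefficient zero (`IsPlanarDrawing.windingSum_eq_zero`).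

The Jordan curve theorem and the structure of face boundaries are avoided. The darts with a face `F`
on their left form a balanced flow (`IsPlanarDrawing.sum_leftFace_sub`), and `c` is a potential
difference on the edges drawn in `frontier F`; so the boundary sum telescopes to zero
(`IsPlanarDrawing.sum_mul_eq_zero_of_isFacialCycle`). -/

namespace BaryDrawing

/-! ### Potentials, dart counts and jumps -/

/-- The sum of potential differences along a walk telescopes. -/
theorem sum_darts_sub {V R : Type*} [AddCommGroup R] {K : SimpleGraph V} (φ : V → R) {u v : V}
    (p : K.Walk u v) : (p.darts.map fun d => φ d.snd - φ d.fst).sum = φ v - φ u := by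
  induction p with
  | nil => simp
  | cons h p ih => simp [ih]

theorem darts_mapLe_sum {V R : Type*} [AddCommMonoid R] {K K' : SimpleGraph V} (hle : K ≤ K')
    (c : V → V → R) {u v : V} (p : K.Walk u v) :
    ((p.mapLe hle).darts.map fun d => c d.fst d.snd).sum =
      (p.darts.map fun d => c d.fst d.snd).sum := by
  induction p with
  | nil => simp
  | cons h p ih => simpa using congrArg (c _ _ + ·) ih

/-- An antisymmetric function on the darts of a finite graph that sums to zero over every cycle
is a potential difference. -/
theorem exists_potential {V : Type*} [Finite V] (K : SimpleGraph V) (c : V → V → ℝ)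
    (hc : ∀ i j, c j i = -c i j)
    (h : ∀ (v : V) (p : K.Walk v v), p.IsCycle → (p.darts.map fun d => c d.fst d.snd).sum = 0) :
    ∃ φ : V → ℝ, ∀ i j, K.Adj i j → c i j = φ j - φ i := by
  classical
  induction K using WellFoundedLT.induction with
  | ind K ih =>
  by_cases hK : ∃ a b, K.Adj a b
  swap
  · push Not at hK
    exact ⟨0, fun i j hij => absurd hij (hK i j)⟩
  obtain ⟨a, b, hab⟩ := hK
  have hle : K.deleteEdges {s(a, b)} ≤ K := K.deleteEdges_le _
  have hlt : K.deleteEdges {s(a, b)} < K := by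
    refine lt_of_le_of_ne hle fun heq => ?_
    have : (K.deleteEdges {s(a, b)}).Adj a b := by rw [heq]; exact hab
    simp [SimpleGraph.deleteEdges_adj] at this
  obtain ⟨φ, hφ⟩ := ih _ hlt fun v p hp => by
    rw [← darts_mapLe_sum hle]
    exact h v _ (hp.mapLe hle)
  have hsplit : ∀ i j, K.Adj i j → (K.deleteEdges {s(a, b)}).Adj i j ∨ s(i, j) = s(a, b) := by
    intro i j hij
    by_cases hs : s(i, j) = s(a, b)
    · exact Or.inr hs
    · exact Or.inl (SimpleGraph.deleteEdges_adj.2 ⟨hij, by simpa using hs⟩)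
  suffices H : ∃ φ : V → ℝ, (∀ i j, (K.deleteEdges {s(a, b)}).Adj i j → c i j = φ j - φ i) ∧
      c a b = φ b - φ a by
    obtain ⟨ψ, h1, h2⟩ := H
    refine ⟨ψ, fun i j hij => ?_⟩
    rcases hsplit i j hij with h' | h'
    · exact h1 i j h'
    · rcases Sym2.eq_iff.1 h' with ⟨rfl, rfl⟩ | ⟨rfl, rfl⟩
      · exact h2
      · rw [hc, h2]; ring
  -- If the ends of the removed edge stay connected, the edge closes a path into a cycle, whose zero
  -- sum forces the value on the edge.
  by_cases hr : (K.deleteEdges {s(a, b)}).Reachable b a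
  · refine ⟨φ, hφ, ?_⟩
    obtain ⟨p, hp⟩ := hr.exists_isPath
    have hcyc : (SimpleGraph.Walk.cons hab (p.mapLe hle)).IsCycle := by
      rw [SimpleGraph.Walk.cons_isCycle_iff]
      refine ⟨hp.mapLe hle, fun hmem => ?_⟩
      rw [SimpleGraph.Walk.edges_mapLe_eq_edges] at hmem
      have := p.edges_subset_edgeSet hmem
      simp at this
    have h0 := h a _ hcyc
    rw [SimpleGraph.Walk.darts_cons, List.map_cons, List.sum_cons, darts_mapLe_sum] at h0
    have h1 : (p.darts.map fun d => c d.fst d.snd) = p.darts.map fun d => φ d.snd - φ d.fst :=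
      List.map_congr_left fun d _ => hφ _ _ d.adj
    rw [h1, sum_darts_sub] at h0
    simp only at h0
    linarith
  -- The edge is a bridge: shifting `φ` by a constant on the component of `b` leaves all other
  -- differences unchanged and corrects the one across the bridge.
  · refine ⟨fun v => φ v + if (K.deleteEdges {s(a, b)}).Reachable b v then
      c a b - φ b + φ a else 0, fun i j hij => ?_, ?_⟩
    · have : (K.deleteEdges {s(a, b)}).Reachable b i ↔ (K.deleteEdges {s(a, b)}).Reachable b j :=
        ⟨fun h => h.trans hij.reachable, fun h => h.trans hij.symm.reachable⟩
      simp only [this, hφ i j hij]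
      ring
    · simp only [hr, if_false, SimpleGraph.Reachable.refl, if_true]
      ring

open scoped Classical in
/-- The number of times a walk traverses the dart from `i` to `j`. -/
noncomputable def dartCount {V : Type*} {K : SimpleGraph V} {u v : V} (p : K.Walk u v) (i j : V) : ℕ :=
  (p.darts.map fun d => (d.fst, d.snd)).count (i, j)

theorem adj_of_dartCount_ne_zero {V : Type*} {K : SimpleGraph V} {u v : V} (p : K.Walk u v)
    {i j : V} (h : dartCount p i j ≠ 0) : K.Adj i j := by
  classical
  have := List.count_pos_iff.1 (Nat.pos_of_ne_zero h)
  obtain ⟨d, -, hd⟩ := List.mem_map.1 this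
  simp only [Prod.mk.injEq] at hd
  rw [← hd.1, ← hd.2]
  exact d.adj

theorem sum_dartCount_smul {V R : Type*} [Fintype V] [AddCommMonoid R] {K : SimpleGraph V} {u v : V}
    (p : K.Walk u v) (c : V → V → R) :
    ∑ i, ∑ j, dartCount p i j • c i j = (p.darts.map fun d => c d.fst d.snd).sum := by
  classical
  induction p with
  | nil => simp [dartCount]
  | @cons a b _ h p ih =>
    rw [SimpleGraph.Walk.darts_cons, List.map_cons, List.sum_cons, ← ih]
    have : ∀ i j, dartCount (SimpleGraph.Walk.cons h p) i j =
        dartCount p i j + if i = a ∧ j = b then 1 else 0 := by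
      intro i j
      simp only [dartCount, SimpleGraph.Walk.darts_cons, List.map_cons, List.count_cons]
      congr 1
      simp only [beq_iff_eq, Prod.mk.injEq, eq_comm (a := i), eq_comm (a := j)]
    simp only [this, add_smul, Finset.sum_add_distrib]
    rw [add_comm]
    congr 1
    rw [Finset.sum_eq_single a, Finset.sum_eq_single b] <;> simp +contextual

/-- If a function on an interval is constant on subintervals avoiding a finite set, its total
variation is the sum of the jumps at the points of that set. -/
theorem sum_jumps (g : ℝ → ℝ) (J : ℝ → ℝ) (a : ℝ) (T : Finset ℝ) :
    ∀ b : ℝ, a ≤ b → (∀ t ∈ T, a < t ∧ t < b) →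
    (∀ x y, a ≤ x → x ≤ y → y ≤ b → (∀ t ∈ T, ¬ (x ≤ t ∧ t ≤ y)) → g x = g y) →
    (∀ t ∈ T, ∀ x y, a ≤ x → x < t → t < y → y ≤ b → (∀ s ∈ T, x ≤ s → s ≤ y → s = t) →
      g y - g x = J t) →
    g b - g a = ∑ t ∈ T, J t := by
  induction T using Finset.induction_on_max with
  | empty =>
    intro b hab _ h _
    simp [h a b le_rfl hab le_rfl (by simp)]
  | insert m T hm ih =>
    intro b hab hT hconst hjump
    have hmT : m ∉ T := fun h => lt_irrefl _ (hm m h)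
    have hmb := hT m (Finset.mem_insert_self _ _)
    obtain ⟨x, hx1, hx2⟩ : ∃ x, (∀ t ∈ insert a T, t < x) ∧ x < m := by
      have : (insert a T).max' (Finset.insert_nonempty _ _) < m := by
        rw [Finset.max'_lt_iff]
        intro t ht
        rcases Finset.mem_insert.1 ht with rfl | ht
        · exact hmb.1
        · exact hm t ht
      obtain ⟨x, h1, h2⟩ := exists_between this
      exact ⟨x, fun t ht => lt_of_le_of_lt (Finset.le_max' _ _ ht) h1, h2⟩
    have hax : a < x := hx1 a (Finset.mem_insert_self _ _)
    have hTx : ∀ t ∈ T, t < x := fun t ht => hx1 t (Finset.mem_insert_of_mem ht)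
    have key : g x - g a = ∑ t ∈ T, J t := by
      refine ih x hax.le (fun t ht => ⟨(hT t (Finset.mem_insert_of_mem ht)).1, hTx t ht⟩)
        (fun y z h1 h2 h3 h4 => hconst y z h1 h2 (by linarith) fun t ht => ?_)
        (fun t ht y z h1 h2 h3 h4 h5 => hjump t (Finset.mem_insert_of_mem ht) y z h1 h2 h3
          (by linarith) fun s hs => ?_)
      · rcases Finset.mem_insert.1 ht with rfl | ht
        · rintro ⟨_, h⟩; linarith
        · exact h4 t ht
      · rcases Finset.mem_insert.1 hs with rfl | hs
        · intro _ h; linarith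
        · exact h5 s hs
    have := hjump m (Finset.mem_insert_self _ _) x b hax.le hx2 hmb.2 le_rfl fun s hs h1 _ => by
      rcases Finset.mem_insert.1 hs with rfl | hs
      · rfl
      · linarith [hTx s hs]
    rw [Finset.sum_insert hmT, ← key, ← this]
    ring

end BaryDrawing

namespace BaryDrawing
open Topology Filter

/-! ### Faces as open connected components -/

section Faces

variable {V : Type*} {G : SimpleGraph V} {γ : V → ℂ}

theorem mem_drawnSet {p : ℂ} :
    p ∈ drawnSet G γ ↔ ∃ k l, (k = l ∨ G.Adj k l) ∧ p ∈ segment ℝ (γ k) (γ l) := by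
  constructor
  · rintro (⟨k, rfl⟩ | ⟨k, l, h, hp⟩)
    · exact ⟨k, k, Or.inl rfl, left_mem_segment _ _ _⟩
    · exact ⟨k, l, Or.inr h, hp⟩
  · rintro ⟨k, l, rfl | h, hp⟩
    · rw [segment_same] at hp
      exact Or.inl ⟨k, hp.symm⟩
    · exact Or.inr ⟨k, l, h, hp⟩

theorem isCompact_segment (a b : ℂ) : IsCompact (segment ℝ a b) := by
  rw [segment_eq_image]
  exact isCompact_Icc.image (by fun_prop)

theorem isClosed_drawnSet [Finite V] (G : SimpleGraph V) (γ : V → ℂ) :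
    IsClosed (drawnSet G γ) := by
  have : drawnSet G γ = ⋃ k, ⋃ l, ⋃ _ : k = l ∨ G.Adj k l, segment ℝ (γ k) (γ l) := by
    ext p
    simp only [mem_drawnSet, Set.mem_iUnion, exists_prop]
  rw [this]
  exact isClosed_iUnion_of_finite fun k => isClosed_iUnion_of_finite fun l =>
    isClosed_iUnion_of_finite fun _ => (isCompact_segment _ _).isClosed

theorem IsFace.isOpen [Finite V] {F : Set ℂ} (h : IsFace G γ F) : IsOpen F := by
  obtain ⟨p, -, rfl⟩ := h
  exact (isClosed_drawnSet G γ).isOpen_compl.connectedComponentIn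

theorem IsFace.isPreconnected {F : Set ℂ} (h : IsFace G γ F) : IsPreconnected F := by
  obtain ⟨p, -, rfl⟩ := h
  exact isPreconnected_connectedComponentIn

theorem IsFace.notMem_drawnSet {F : Set ℂ} (h : IsFace G γ F) {p : ℂ} (hp : p ∈ F) :
    p ∉ drawnSet G γ := by
  obtain ⟨q, -, rfl⟩ := h
  exact connectedComponentIn_subset _ _ hp

theorem IsFace.eq_connectedComponentIn {F : Set ℂ} (h : IsFace G γ F) {p : ℂ} (hp : p ∈ F) :
    F = connectedComponentIn (drawnSet G γ)ᶜ p := by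
  obtain ⟨q, -, rfl⟩ := h
  exact connectedComponentIn_eq hp

theorem IsFace.eq_of_mem {F F' : Set ℂ} (h : IsFace G γ F) (h' : IsFace G γ F') {p : ℂ}
    (hp : p ∈ F) (hp' : p ∈ F') : F = F' :=
  (h.eq_connectedComponentIn hp).trans (h'.eq_connectedComponentIn hp').symm

theorem IsFace.subset_of_isPreconnected {F S : Set ℂ} (h : IsFace G γ F) (hS : IsPreconnected S)
    (hSd : ∀ p ∈ S, p ∉ drawnSet G γ) {p : ℂ} (hpS : p ∈ S) (hpF : p ∈ F) : S ⊆ F := by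
  rw [h.eq_connectedComponentIn hpF]
  exact hS.subset_connectedComponentIn hpS hSd

theorem isFace_connectedComponentIn {p : ℂ} (hp : p ∉ drawnSet G γ) :
    IsFace G γ (connectedComponentIn (drawnSet G γ)ᶜ p) := ⟨p, hp, rfl⟩

end Faces

/-! ### The face on the left of an edge -/

section ThinTriangles

/-- The open triangle on the left side of the segment from `0` to `1` with slope `ε`. -/
def thinTriangle (ε : ℝ) : Set ℂ :=
  {z | 0 < z.im ∧ z.im < ε * z.re ∧ z.im < ε * (1 - z.re)}

theorem convex_thinTriangle (ε : ℝ) : Convex ℝ (thinTriangle ε) := by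
  have h1 : Convex ℝ {z : ℂ | 0 < z.im} := convex_halfSpace_im_gt 0
  have h2 : Convex ℝ {z : ℂ | z.im - ε * z.re < 0} :=
    convex_halfSpace_lt (f := fun z : ℂ => z.im - ε * z.re)
      ⟨fun x y => by simp; ring, fun c x => by simp; ring⟩ 0
  have h3 : Convex ℝ {z : ℂ | z.im + ε * z.re < ε} :=
    convex_halfSpace_lt (f := fun z : ℂ => z.im + ε * z.re)
      ⟨fun x y => by simp; ring, fun c x => by simp; ring⟩ ε
  convert h1.inter (h2.inter h3) using 1
  ext z
  simp only [thinTriangle, Set.mem_ofPred_eq, Set.mem_inter_iff]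
  constructor <;> rintro ⟨h1, h2, h3⟩ <;> refine ⟨h1, ?_, ?_⟩ <;> linarith

/-- A point `t • b` of the triangle forces `0 < b.im < ε * b.re`, which fails for small `ε`. -/
theorem eventually_disjoint_thinTriangle_zero (b : ℂ) :
    ∀ᶠ ε in 𝓝[>] (0 : ℝ), Disjoint (thinTriangle ε) (segment ℝ 0 b) := by
  have key : ∀ ε : ℝ, (0 < b.im → ε * b.re < b.im) →
      Disjoint (thinTriangle ε) (segment ℝ 0 b) := by
    intro ε hε
    rw [Set.disjoint_left]
    rintro z ⟨h1, h2, -⟩ ⟨s, t, -, ht, -, rfl⟩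
    simp only [smul_zero, zero_add, Complex.smul_im, Complex.smul_re, smul_eq_mul] at h1 h2
    have := hε (pos_of_mul_pos_right h1 ht)
    nlinarith
  have hlim : Tendsto (fun ε : ℝ => ε * b.re) (𝓝[>] 0) (𝓝 0) := by
    have : Continuous fun ε : ℝ => ε * b.re := by fun_prop
    simpa using (this.tendsto 0).mono_left nhdsWithin_le_nhds
  by_cases hb : 0 < b.im
  · filter_upwards [hlim.eventually_lt_const hb] with ε hε using key ε fun _ => hε
  · exact Eventually.of_forall fun ε => key ε fun h => absurd h hb

/-- The reflection `z ↦ 1 - conj z` preserves the triangle and exchanges `0` and `1`. -/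
theorem eventually_disjoint_thinTriangle_one (b : ℂ) :
    ∀ᶠ ε in 𝓝[>] (0 : ℝ), Disjoint (thinTriangle ε) (segment ℝ 1 b) := by
  filter_upwards [eventually_disjoint_thinTriangle_zero (1 - starRingEnd ℂ b)] with ε hε
  rw [Set.disjoint_left] at hε ⊢
  rintro z ⟨h1, h2, h3⟩ ⟨s, t, hs, ht, hst, rfl⟩
  refine hε (a := 1 - starRingEnd ℂ (s • 1 + t • b)) ⟨?_, ?_, ?_⟩ ⟨s, t, hs, ht, hst, ?_⟩
  · simpa using h1
  · simpa using h3
  · simpa using h2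
  · have : (s : ℂ) + t = 1 := by exact_mod_cast hst
    simp only [smul_zero, zero_add, map_add, Complex.real_smul, map_mul, Complex.conj_ofReal,
      map_one]
    linear_combination this

theorem eventually_disjoint_thinTriangle {a b : ℂ}
    (h : Disjoint (segment ℝ 0 1) (segment ℝ a b) ∨ a = 0 ∨ a = 1 ∨ b = 0 ∨ b = 1) :
    ∀ᶠ ε in 𝓝[>] (0 : ℝ), Disjoint (thinTriangle ε) (segment ℝ a b) := by
  rcases h with h | rfl | rfl | rfl | rfl
  · obtain ⟨δ, hδ, hd⟩ := h.exists_thickenings (isCompact_segment 0 1)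
      (isCompact_segment a b).isClosed
    filter_upwards [Ioo_mem_nhdsGT hδ] with ε hε
    refine hd.mono ?_ (Metric.self_subset_thickening hδ _)
    rintro z ⟨h1, h2, h3⟩
    have hr0 := pos_of_mul_pos_right (h1.trans h2) hε.1.le
    have hr1 := pos_of_mul_pos_right (h1.trans h3) hε.1.le
    rw [Metric.mem_thickening_iff]
    refine ⟨z.re, ⟨1 - z.re, z.re, hr1.le, hr0.le, by ring, by simp⟩, ?_⟩
    have : z - z.re = z.im * Complex.I := by
      nth_rw 1 [← Complex.re_add_im z]; ring
    rw [dist_eq_norm, this, norm_mul, Complex.norm_I, mul_one, Complex.norm_real,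
      Real.norm_eq_abs, abs_of_pos h1]
    nlinarith [hε.1, hε.2]
  · exact eventually_disjoint_thinTriangle_zero b
  · exact eventually_disjoint_thinTriangle_one b
  · simpa only [segment_symm ℝ a 0] using eventually_disjoint_thinTriangle_zero a
  · simpa only [segment_symm ℝ a 1] using eventually_disjoint_thinTriangle_one a

/-- The similarity `z ↦ a + z * d` reduces every edge to the segment from `0` to `1`. -/
theorem add_mul_mem_segment_iff {a d z x y : ℂ} (hd : d ≠ 0) :
    a + z * d ∈ segment ℝ x y ↔ z ∈ segment ℝ ((x - a) / d) ((y - a) / d) := by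
  constructor <;> rintro ⟨s, t, hs, ht, hst, h⟩ <;> refine ⟨s, t, hs, ht, hst, ?_⟩ <;>
    have hst' : (s : ℂ) + t = 1 := by exact_mod_cast hst
  · simp only [Complex.real_smul] at h ⊢
    field_simp
    linear_combination h - a * hst'
  · simp only [Complex.real_smul] at h ⊢
    field_simp at h
    linear_combination h + a * hst'

variable {V : Type*} {G : SimpleGraph V} {γ : V → ℂ}

theorem IsPlanarDrawing.sub_ne_zero (hγ : IsPlanarDrawing G γ) {i j : V} (h : i ≠ j) :
    γ j - γ i ≠ 0 := fun h0 => h (hγ.injective (_root_.sub_eq_zero.1 h0).symm)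

/-- By planarity, any other vertex or edge is either disjoint from the edge or shares an end with
it, and in both cases a flat enough triangle misses it. Finiteness gives a common `ε`. -/
theorem IsPlanarDrawing.eventually_thinTriangle [Finite V] (hγ : IsPlanarDrawing G γ) {i j : V}
    (hij : G.Adj i j) :
    ∀ᶠ ε in 𝓝[>] (0 : ℝ), ∀ z ∈ thinTriangle ε, γ i + z * (γ j - γ i) ∉ drawnSet G γ := by
  have hd := hγ.sub_ne_zero hij.ne
  have key : ∀ k l, k = l ∨ G.Adj k l → ∀ᶠ ε in 𝓝[>] (0 : ℝ), ∀ z ∈ thinTriangle ε,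
      γ i + z * (γ j - γ i) ∉ segment ℝ (γ k) (γ l) := by
    intro k l hkl
    refine (eventually_disjoint_thinTriangle (a := (γ k - γ i) / (γ j - γ i))
      (b := (γ l - γ i) / (γ j - γ i)) ?_).mono fun ε hε z hz h => ?_
    · by_contra! hcon
      obtain ⟨h0, h1, h2, h3, h4⟩ := hcon
      have hki : k ≠ i := by rintro rfl; simp at h1
      have hli : l ≠ i := by rintro rfl; simp at h3
      have hkj : k ≠ j := by rintro rfl; exact h2 (div_self hd)
      have hlj : l ≠ j := by rintro rfl; exact h4 (div_self hd)
      obtain ⟨z, hz1, hz2⟩ := Set.not_disjoint_iff.1 h0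
      rw [← add_mul_mem_segment_iff hd] at hz2
      have hz1' : γ i + z * (γ j - γ i) ∈ segment ℝ (γ i) (γ j) := by
        rw [add_mul_mem_segment_iff hd]
        simpa [div_self hd] using hz1
      rcases hkl with rfl | hkl
      · rw [segment_same, Set.mem_singleton_iff] at hz2
        rw [hz2] at hz1'
        rcases hγ.vertex_on_edge _ _ _ hij hz1' with h | h
        · exact hki h
        · exact hkj h
      · have hne : s(i, j) ≠ s(k, l) := by
          intro h
          rcases Sym2.eq_iff.1 h with ⟨h, -⟩ | ⟨h, -⟩
          · exact hki h.symm
          · exact hli h.symm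
        obtain ⟨v, hv1, hv2, -⟩ := hγ.edge_inter i j k l hij hkl hne _ hz1' hz2
        rw [Sym2.mem_iff] at hv1 hv2
        rcases hv1 with rfl | rfl <;> rcases hv2 with rfl | rfl <;> contradiction
    · rw [add_mul_mem_segment_iff hd] at h
      exact Set.disjoint_left.1 hε hz h
  have := (eventually_all (l := 𝓝[>] (0 : ℝ))).2 fun k : V => eventually_all.2 fun l : V =>
    eventually_all.2 fun h : k = l ∨ G.Adj k l => key k l h
  filter_upwards [this] with ε hε z hz hmem
  obtain ⟨k, l, hkl, h⟩ := mem_drawnSet.1 hmem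
  exact hε k l hkl z hz h

/-- `F` is the face on the left side of the edge drawn from `γ i` to `γ j`. -/
def IsLeftFace (G : SimpleGraph V) (γ : V → ℂ) (i j : V) (F : Set ℂ) : Prop :=
  IsFace G γ F ∧ ∃ ε > 0, ∀ z ∈ thinTriangle ε, γ i + z * (γ j - γ i) ∈ F

theorem eventually_add_mul_I_mem_thinTriangle {ε : ℝ} (hε : 0 < ε) {x : ℝ} (h0 : 0 < x)
    (h1 : x < 1) : ∀ᶠ η : ℝ in 𝓝[>] (0 : ℝ), (x + η * Complex.I : ℂ) ∈ thinTriangle ε := by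
  have h1' : 0 < 1 - x := by linarith
  filter_upwards [Ioo_mem_nhdsGT (mul_pos hε h0), Ioo_mem_nhdsGT (mul_pos hε h1')] with η h2 h3
  exact ⟨by simpa using h2.1, by simpa using h2.2, by simpa using h3.2⟩

theorem thinTriangle_nonempty {ε : ℝ} (hε : 0 < ε) : (thinTriangle ε).Nonempty :=
  let ⟨_, h⟩ := (eventually_add_mul_I_mem_thinTriangle hε (x := 1 / 2) (by norm_num)
    (by norm_num)).exists
  ⟨_, h⟩

theorem IsPlanarDrawing.exists_isLeftFace [Finite V] (hγ : IsPlanarDrawing G γ) {i j : V}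
    (hij : G.Adj i j) : ∃ F, IsLeftFace G γ i j F := by
  obtain ⟨ε, h, hε⟩ := ((hγ.eventually_thinTriangle hij).and self_mem_nhdsWithin).exists
  obtain ⟨z₀, hz₀⟩ := thinTriangle_nonempty hε
  have hF := isFace_connectedComponentIn (h z₀ hz₀)
  refine ⟨_, hF, ε, hε, fun z hz => ?_⟩
  refine hF.subset_of_isPreconnected (S := (fun z => γ i + z * (γ j - γ i)) '' thinTriangle ε)
    ((convex_thinTriangle ε).isPreconnected.image _ (by fun_prop)) ?_
    (Set.mem_image_of_mem _ hz₀) (mem_connectedComponentIn (h z₀ hz₀)) (Set.mem_image_of_mem _ hz)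
  rintro _ ⟨z, hz, rfl⟩
  exact h z hz

/-- The face on the left side of the edge drawn from `γ i` to `γ j`. -/
noncomputable def leftFace (G : SimpleGraph V) (γ : V → ℂ) (i j : V) : Set ℂ :=
  Classical.epsilon (IsLeftFace G γ i j)

theorem IsPlanarDrawing.isLeftFace_leftFace [Finite V] (hγ : IsPlanarDrawing G γ) {i j : V}
    (hij : G.Adj i j) : IsLeftFace G γ i j (leftFace G γ i j) :=
  Classical.epsilon_spec (hγ.exists_isLeftFace hij)

theorem IsFace.frontier_eq [Finite V] {F : Set ℂ} (hF : IsFace G γ F) :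
    frontier F = closure F \ F := by
  rw [frontier, hF.isOpen.interior_eq]

theorem IsLeftFace.segment_subset_frontier [Finite V] {i j : V} {F : Set ℂ}
    (h : IsLeftFace G γ i j F) (hij : G.Adj i j) : segment ℝ (γ i) (γ j) ⊆ frontier F := by
  obtain ⟨hF, ε, hε, hεF⟩ := h
  have hcl : openSegment ℝ (γ i) (γ j) ⊆ closure F := by
    rintro _ ⟨s, t, hs, ht, hst, rfl⟩
    have ht1 : t < 1 := by linarith
    have hst' : (s : ℂ) + t = 1 := by exact_mod_cast hst
    have hlim : Tendsto (fun η : ℝ => γ i + (t + η * Complex.I) * (γ j - γ i)) (𝓝[>] 0)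
        (𝓝 (s • γ i + t • γ j)) := by
      have : Continuous fun η : ℝ => γ i + (t + η * Complex.I) * (γ j - γ i) := by fun_prop
      have h0 := (this.tendsto 0).mono_left (nhdsWithin_le_nhds (s := Set.Ioi 0))
      convert h0 using 2
      simp only [Complex.real_smul, Complex.ofReal_zero, zero_mul, add_zero]
      linear_combination γ i * hst'
    refine mem_closure_of_tendsto hlim ?_
    filter_upwards [eventually_add_mul_I_mem_thinTriangle hε ht ht1] with η hη using hεF _ hη
  intro p hp
  rw [hF.frontier_eq]
  refine ⟨closure_minimal hcl isClosed_closure (segment_subset_closure_openSegment hp), fun h => ?_⟩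
  exact hF.notMem_drawnSet h (mem_drawnSet.2 ⟨i, j, Or.inr hij, hp⟩)

end ThinTriangles

end BaryDrawing

namespace BaryDrawing
open Topology Filter

/-! ### Going around a vertex -/

section Rotation

variable {V : Type*} {G : SimpleGraph V} {γ : V → ℂ}

/-- Two neighbours of `v` seen from `v` in the same direction coincide. -/
theorem IsPlanarDrawing.eq_of_sameRay (hγ : IsPlanarDrawing G γ) {v u u' : V} (hu : G.Adj v u)
    (hu' : G.Adj v u') {κ : ℝ} (hκ : 0 < κ) (h : γ u - γ v = κ * (γ u' - γ v)) : u = u' := by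
  wlog hκ1 : κ ≤ 1 generalizing u u' κ
  · refine (this hu' hu (inv_pos.2 hκ) ?_ (inv_le_one_of_one_le₀ (by linarith))).symm
    have : (κ : ℂ) ≠ 0 := by exact_mod_cast hκ.ne'
    rw [h]
    push_cast
    field_simp
  have : γ u ∈ segment ℝ (γ v) (γ u') := by
    refine ⟨1 - κ, κ, by linarith, hκ.le, by ring, ?_⟩
    simp only [Complex.real_smul]
    push_cast
    linear_combination -h
  rcases hγ.vertex_on_edge _ _ _ hu' this with h | h
  · exact absurd h hu.ne'
  · exact h

theorem eventually_small_circle {a b c : ℂ} (h : c ∉ segment ℝ a b) :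
    ∀ᶠ r in 𝓝[>] (0 : ℝ), ∀ p : ℂ, ‖p - c‖ = r → p ∉ segment ℝ a b := by
  obtain ⟨δ, hδ, hb⟩ := Metric.isOpen_iff.1 (isCompact_segment a b).isClosed.isOpen_compl c h
  filter_upwards [Ioo_mem_nhdsGT hδ] with r hr p hp
  exact hb (by rw [Metric.mem_ball, dist_eq_norm, hp]; exact hr.2)

/-- On a small circle around one end of an edge, a point just counterclockwise of the edge is in its
left triangle. A point just clockwise, seen from the other end, is in the left triangle of the
reversed edge. -/
theorem eventually_smul_exp_mem_thinTriangle {ε κ : ℝ} (hε : 0 < ε) (hκ0 : 0 < κ) (hκ1 : κ < 1) :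
    ∀ᶠ δ : ℝ in 𝓝[>] (0 : ℝ), (κ * Complex.exp (δ * Complex.I) : ℂ) ∈ thinTriangle ε ∧
      (1 - κ * Complex.exp (-δ * Complex.I) : ℂ) ∈ thinTriangle ε := by
  have h1 : Tendsto (fun δ : ℝ => κ * Real.sin δ - ε * (κ * Real.cos δ)) (𝓝[>] 0)
      (𝓝 (-(ε * κ))) := by
    have : Continuous fun δ : ℝ => κ * Real.sin δ - ε * (κ * Real.cos δ) := by fun_prop
    simpa using (this.tendsto 0).mono_left nhdsWithin_le_nhds
  have h2 : Tendsto (fun δ : ℝ => κ * Real.sin δ - ε * (1 - κ * Real.cos δ)) (𝓝[>] 0)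
      (𝓝 (-(ε * (1 - κ)))) := by
    have : Continuous fun δ : ℝ => κ * Real.sin δ - ε * (1 - κ * Real.cos δ) := by fun_prop
    simpa using (this.tendsto 0).mono_left nhdsWithin_le_nhds
  have h1' : -(ε * κ) < 0 := by have := mul_pos hε hκ0; linarith
  have h2' : -(ε * (1 - κ)) < 0 := by
    have := mul_pos hε (sub_pos.2 hκ1); linarith
  filter_upwards [h1.eventually_lt_const h1', h2.eventually_lt_const h2',
    Ioo_mem_nhdsGT Real.pi_pos] with δ h3 h4 h5
  have hs := mul_pos hκ0 (Real.sin_pos_of_pos_of_lt_pi h5.1 h5.2)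
  have hre : (κ * Complex.exp (δ * Complex.I) : ℂ).re = κ * Real.cos δ := by
    rw [Complex.re_ofReal_mul, Complex.exp_ofReal_mul_I_re]
  have him : (κ * Complex.exp (δ * Complex.I) : ℂ).im = κ * Real.sin δ := by
    rw [Complex.im_ofReal_mul, Complex.exp_ofReal_mul_I_im]
  have hre' : (κ * Complex.exp (-δ * Complex.I) : ℂ).re = κ * Real.cos δ := by
    rw [← Complex.ofReal_neg, Complex.re_ofReal_mul, Complex.exp_ofReal_mul_I_re, Real.cos_neg]
  have him' : (κ * Complex.exp (-δ * Complex.I) : ℂ).im = -(κ * Real.sin δ) := by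
    rw [← Complex.ofReal_neg, Complex.im_ofReal_mul, Complex.exp_ofReal_mul_I_im, Real.sin_neg,
      mul_neg]
  refine ⟨⟨?_, ?_, ?_⟩, ?_, ?_, ?_⟩ <;>
    simp only [Complex.sub_re, Complex.sub_im, Complex.one_re, Complex.one_im, hre, him, hre', him']
    <;> linarith

/-- Rotating by `ζ` keeps all edge directions off the cut of `arg`, so that no jump occurs where the
parametrised circle closes up. -/
theorem exists_unit_not_neg_ray [Finite V] (S : Set V) (x : V → ℂ) :
    ∃ ζ : ℂ, ‖ζ‖ = 1 ∧ ∀ u ∈ S, x u ≠ 0 → (x u / ζ).arg ≠ Real.pi := by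
  obtain ⟨θ, hθ, hθ'⟩ := (Set.Ioo_infinite (a := -Real.pi) (b := Real.pi)
    (by linarith [Real.pi_pos])).exists_notMem_finite (Set.finite_range fun u => (x u).arg)
  refine ⟨-Complex.exp (θ * Complex.I), by rw [norm_neg, Complex.norm_exp_ofReal_mul_I],
    fun u _ hu0 h => hθ' ⟨u, ?_⟩⟩
  rw [Complex.arg_eq_pi_iff] at h
  have hx : x u = (-(x u / -Complex.exp (θ * Complex.I)).re : ℝ) * Complex.exp (θ * Complex.I) := by
    have he : (x u / -Complex.exp (θ * Complex.I)) =
        ((x u / -Complex.exp (θ * Complex.I)).re : ℂ) := Complex.ext (by simp) (by simpa using h.2)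
    have hne := Complex.exp_ne_zero (θ * Complex.I)
    rw [Complex.ofReal_neg, ← he]
    field_simp
  simp only
  rw [hx, Complex.arg_real_mul _ (by linarith [h.1]), Complex.arg_exp_mul_I,
    toIocMod_eq_self Real.two_pi_pos]
  exact ⟨hθ.1, by linarith [hθ.2]⟩

open scoped Classical in
/-- Around every vertex, a face is as often to the left of outgoing edges as it is to the left of
incoming ones. -/
theorem IsPlanarDrawing.sum_leftFace_sub [Fintype V] (hγ : IsPlanarDrawing G γ) (v : V)
    {F : Set ℂ} (hF : IsFace G γ F) :
    ∑ u ∈ G.neighborFinset v, ((if leftFace G γ v u = F then 1 else 0) -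
      (if leftFace G γ u v = F then (1 : ℝ) else 0)) = 0 := by
  obtain ⟨ζ, hζ, hζpi⟩ := exists_unit_not_neg_ray {u | G.Adj v u} fun u => γ u - γ v
  have hζ0 : ζ ≠ 0 := by rintro rfl; simp at hζ
  set τ : V → ℝ := fun u => ((γ u - γ v) / ζ).arg with hτ
  have hτpi : ∀ u, G.Adj v u → -Real.pi < τ u ∧ τ u < Real.pi := fun u hu =>
    ⟨Complex.neg_pi_lt_arg _, lt_of_le_of_ne (Complex.arg_le_pi _)
      (hζpi u hu (hγ.sub_ne_zero hu.ne))⟩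
  have hpolar : ∀ u, γ u - γ v = ‖γ u - γ v‖ * ζ * Complex.exp (τ u * Complex.I) := by
    intro u
    have := Complex.norm_mul_exp_arg_mul_I ((γ u - γ v) / ζ)
    rw [norm_div, hζ, div_one] at this
    rw [mul_right_comm, this]
    field_simp
  have hτinj : ∀ u u', G.Adj v u → G.Adj v u' → τ u = τ u' → u = u' := by
    intro u u' hu hu' h
    have h0 := norm_pos_iff.2 (hγ.sub_ne_zero hu.ne)
    have h0' := norm_pos_iff.2 (hγ.sub_ne_zero hu'.ne)
    refine hγ.eq_of_sameRay hu hu' (div_pos h0 h0') ?_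
    have e := hpolar u
    have e' := hpolar u'
    rw [h] at e
    have : (‖γ u' - γ v‖ : ℂ) ≠ 0 := by exact_mod_cast h0'.ne'
    rw [Complex.ofReal_div, div_mul_eq_mul_div, eq_div_iff this]
    linear_combination (‖γ u' - γ v‖ : ℂ) * e - ‖γ u - γ v‖ * e'
  -- The circle of radius `r` meets only edges ending at `v`, and each neighbour lies outside it.
  obtain ⟨r, ⟨hr, hrN⟩, hr0⟩ : ∃ r : ℝ, ((∀ k l, γ v ∉ segment ℝ (γ k) (γ l) →
      ∀ p : ℂ, ‖p - γ v‖ = r → p ∉ segment ℝ (γ k) (γ l)) ∧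
      ∀ u, G.Adj v u → r < ‖γ u - γ v‖) ∧ 0 < r := by
    have h1 : ∀ᶠ r in 𝓝[>] (0 : ℝ), ∀ k l, γ v ∉ segment ℝ (γ k) (γ l) →
        ∀ p : ℂ, ‖p - γ v‖ = r → p ∉ segment ℝ (γ k) (γ l) :=
      eventually_all.2 fun k => eventually_all.2 fun l => eventually_all.2 fun h =>
        eventually_small_circle h
    have h2 : ∀ᶠ r in 𝓝[>] (0 : ℝ), ∀ u, G.Adj v u → r < ‖γ u - γ v‖ :=
      eventually_all.2 fun u => eventually_all.2 fun hu =>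
        (eventually_lt_nhds (norm_pos_iff.2 (hγ.sub_ne_zero hu.ne))).filter_mono nhdsWithin_le_nhds
    exact ((h1.and h2).and self_mem_nhdsWithin).exists
  set P : ℝ → ℂ := fun t => γ v + r * ζ * Complex.exp (t * Complex.I) with hP
  have hPcont : Continuous P := by fun_prop
  have hPv : ∀ t, ‖P t - γ v‖ = r := by
    intro t
    simp only [hP, add_sub_cancel_left, norm_mul, hζ, Complex.norm_exp_ofReal_mul_I, mul_one,
      Complex.norm_real, Real.norm_eq_abs, abs_of_pos hr0]
  have hPu : ∀ u, G.Adj v u → ∀ t, -Real.pi ≤ t → t ≤ Real.pi →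
      P t ∈ segment ℝ (γ v) (γ u) → t = τ u := by
    rintro u hu t ht1 ht2 ⟨a, b, ha, hb, hab, h⟩
    have hab' : (a : ℂ) + b = 1 := by exact_mod_cast hab
    have h1 : P t - γ v = b * (γ u - γ v) := by
      rw [← h]
      simp only [Complex.real_smul]
      linear_combination γ v * hab'
    have hb0 : 0 < b := by
      refine lt_of_le_of_ne hb fun h0 => ?_
      have := hPv t
      rw [h1, ← h0] at this
      simp at this
      exact hr0.ne this
    have h2 : (r : ℂ) * Complex.exp (t * Complex.I) = b * ((γ u - γ v) / ζ) := by
      rw [← mul_div_assoc, ← h1]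
      simp only [hP, add_sub_cancel_left]
      field_simp
    have h3 := congrArg Complex.arg h2
    rw [Complex.arg_real_mul _ hr0, Complex.arg_real_mul _ hb0, Complex.arg_exp_mul_I] at h3
    -- The parameter `-π` gives the direction of argument `π`, which the choice of `ζ` excludes.
    rcases eq_or_lt_of_le ht1 with rfl | ht1
    · have : toIocMod Real.two_pi_pos (-Real.pi) (-Real.pi) = Real.pi := by
        rw [toIocMod_apply_left]; ring
      rw [this] at h3
      exact absurd h3.symm (hτpi u hu).2.ne
    · rwa [(toIocMod_eq_self Real.two_pi_pos).2 ⟨ht1, by linarith⟩] at h3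
  have hPdrawn : ∀ t, -Real.pi ≤ t → t ≤ Real.pi → (∀ u, G.Adj v u → t ≠ τ u) →
      P t ∉ drawnSet G γ := by
    intro t ht1 ht2 ht hmem
    obtain ⟨k, l, hkl, hp⟩ := mem_drawnSet.1 hmem
    by_cases hv : γ v ∈ segment ℝ (γ k) (γ l)
    swap
    · exact hr k l hv _ (hPv t) hp
    rcases hkl with rfl | hkl
    · rw [segment_same, Set.mem_singleton_iff] at hv hp
      have := hPv t
      rw [hp, hv, sub_self, norm_zero] at this
      exact hr0.ne this
    · rcases hγ.vertex_on_edge _ _ _ hkl hv with rfl | rfl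
      · exact ht l hkl (hPu l hkl t ht1 ht2 hp)
      · rw [segment_symm] at hp
        exact ht k hkl.symm (hPu k hkl.symm t ht1 ht2 hp)
  -- The indicator of `F` along the circle changes only at edges, passing from the face right of `v
  -- u` to the face left of it. Its total change over a full turn is zero.
  set g : ℝ → ℝ := fun t => if P t ∈ F then 1 else 0 with hg
  set N := G.neighborFinset v with hN
  have hmemN : ∀ u, u ∈ N ↔ G.Adj v u := fun u => G.mem_neighborFinset v u
  have hconst : ∀ x y, -Real.pi ≤ x → x ≤ y → y ≤ Real.pi →
      (∀ u, G.Adj v u → ¬ (x ≤ τ u ∧ τ u ≤ y)) → g x = g y := by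
    intro x y hx hxy hy hav
    have hpre : IsPreconnected (P '' Set.Icc x y) := isPreconnected_Icc.image _ hPcont.continuousOn
    have hdr : ∀ p ∈ P '' Set.Icc x y, p ∉ drawnSet G γ := by
      rintro _ ⟨t, ⟨ht1, ht2⟩, rfl⟩
      refine hPdrawn t (by linarith) (by linarith) fun u hu h => hav u hu ?_
      exact ⟨h ▸ ht1, h ▸ ht2⟩
    have hxm : P x ∈ P '' Set.Icc x y := Set.mem_image_of_mem _ ⟨le_rfl, hxy⟩
    have hym : P y ∈ P '' Set.Icc x y := Set.mem_image_of_mem _ ⟨hxy, le_rfl⟩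
    have : P x ∈ F ↔ P y ∈ F :=
      ⟨fun h => hF.subset_of_isPreconnected hpre hdr hxm h hym,
        fun h => hF.subset_of_isPreconnected hpre hdr hym h hxm⟩
    simp only [hg, this]
  set J : V → ℝ := fun u => (if leftFace G γ v u = F then 1 else 0) -
      (if leftFace G γ u v = F then (1 : ℝ) else 0) with hJ
  have hjump : ∀ u, G.Adj v u → ∀ x y, -Real.pi ≤ x → x < τ u → τ u < y → y ≤ Real.pi →
      (∀ u', G.Adj v u' → x ≤ τ u' → τ u' ≤ y → τ u' = τ u) → g y - g x = J u := by
    intro u hu x y hx hxu huy hy hav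
    have hρ := hrN u hu
    have hρ0 := hr0.trans hρ
    obtain ⟨hL, ε, hε, hεF⟩ := hγ.isLeftFace_leftFace hu
    obtain ⟨hL', ε', hε', hεF'⟩ := hγ.isLeftFace_leftFace hu.symm
    have hκ0 : 0 < r / ‖γ u - γ v‖ := div_pos hr0 hρ0
    have hκ1 : r / ‖γ u - γ v‖ < 1 := (div_lt_one hρ0).2 hρ
    obtain ⟨δ, ⟨h1, h2⟩, h3, h4⟩ := (((eventually_smul_exp_mem_thinTriangle hε hκ0 hκ1).and
      (eventually_smul_exp_mem_thinTriangle hε' hκ0 hκ1)).and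
      (inter_mem (Ioo_mem_nhdsGT (sub_pos.2 huy)) (Ioo_mem_nhdsGT (sub_pos.2 hxu)))).exists
    have hPδ : ∀ δ : ℝ, P (τ u + δ) = γ v + ((r / ‖γ u - γ v‖ : ℝ) *
        Complex.exp (δ * Complex.I)) * (γ u - γ v) := by
      intro δ
      have hne : (‖γ u - γ v‖ : ℂ) ≠ 0 := by exact_mod_cast hρ0.ne'
      have e : (r / ‖γ u - γ v‖ : ℂ) * Complex.exp (δ * Complex.I) * (γ u - γ v) =
          r * ζ * (Complex.exp (τ u * Complex.I) * Complex.exp (δ * Complex.I)) := by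
        rw [div_mul_eq_mul_div, div_mul_eq_mul_div, div_eq_iff hne]
        linear_combination r * Complex.exp (δ * Complex.I) * hpolar u
      rw [Complex.ofReal_div, e]
      simp only [hP]
      rw [Complex.ofReal_add, add_mul, Complex.exp_add]
    have h5 : P (τ u + δ) ∈ leftFace G γ v u := by
      rw [hPδ]
      exact hεF _ h1.1
    have h6 : P (τ u - δ) ∈ leftFace G γ u v := by
      rw [sub_eq_add_neg, hPδ]
      convert hεF' _ h2.2 using 1
      push_cast
      ring
    have hiff : ∀ {L : Set ℂ} {p : ℂ}, IsFace G γ L → p ∈ L → (p ∈ F ↔ L = F) :=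
      fun hL hp => ⟨fun h => hL.eq_of_mem hF hp h, fun h => h ▸ hp⟩
    have h7 : g (τ u + δ) = g y := hconst _ _ (by linarith [h3.1]) (by linarith [h3.2]) hy
      fun u' hu' ⟨ha, hb⟩ => by
        have := hav u' hu' (by linarith [h3.1]) hb
        linarith [h3.1]
    have h8 : g x = g (τ u - δ) := hconst _ _ hx (by linarith [h4.2]) (by linarith [h4.1])
      fun u' hu' ⟨ha, hb⟩ => by
        have := hav u' hu' ha (by linarith [h4.1])
        linarith [h4.1]
    rw [← h7, h8]
    simp only [hg, hJ, hiff hL h5, hiff hL' h6]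
  have hends : g Real.pi - g (-Real.pi) = 0 := by
    have : P Real.pi = P (-Real.pi) := by
      simp [hP, Complex.exp_neg, Complex.exp_pi_mul_I]
    simp only [hg, this, sub_self]
  have hsum := sum_jumps g (fun t => ∑ u ∈ N with τ u = t, J u) (-Real.pi) (N.image τ) Real.pi
    (by linarith [Real.pi_pos])
    (fun t ht => by
      obtain ⟨u, hu, rfl⟩ := Finset.mem_image.1 ht
      exact hτpi u ((hmemN u).1 hu))
    (fun x y hx hxy hy h => hconst x y hx hxy hy fun u hu =>
      h _ (Finset.mem_image_of_mem _ ((hmemN u).2 hu)))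
    (fun t ht x y hx hxt hty hy h => by
      obtain ⟨u, hu, rfl⟩ := Finset.mem_image.1 ht
      have hu' := (hmemN u).1 hu
      rw [hjump u hu' x y hx hxt hty hy fun u' hu' =>
        h _ (Finset.mem_image_of_mem _ ((hmemN u').2 hu'))]
      have : N.filter (fun u' => τ u' = τ u) = {u} := by
        ext u'
        simp only [Finset.mem_filter, Finset.mem_singleton]
        exact ⟨fun h => hτinj _ _ ((hmemN u').1 h.1) hu' h.2, fun h => by subst h; exact ⟨hu, rfl⟩⟩
      rw [this, Finset.sum_singleton])
  rw [hends, Finset.sum_fiberwise_of_maps_to fun u hu => Finset.mem_image_of_mem _ hu] at hsum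
  exact hsum.symm

end Rotation

end BaryDrawing

namespace BaryDrawing
open Topology Filter

/-! ### Winding numbers of closed walks -/

section Winding

/-- If the ratio were `-s` with `s ≥ 0`, then `x = (s * a + b) / (1 + s)` would lie on the segment.
-/
theorem div_mem_slitPlane {a b x : ℂ} (hx : x ∉ segment ℝ a b) :
    a - x ≠ 0 ∧ b - x ≠ 0 ∧ (b - x) / (a - x) ∈ Complex.slitPlane := by
  have ha : a - x ≠ 0 := fun h => hx (sub_eq_zero.1 h ▸ left_mem_segment ℝ a b)
  have hb : b - x ≠ 0 := fun h => hx (sub_eq_zero.1 h ▸ right_mem_segment ℝ a b)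
  refine ⟨ha, hb, ?_⟩
  by_contra hs
  rw [Complex.mem_slitPlane_iff, not_or, not_lt, not_not] at hs
  obtain ⟨hre, him⟩ := hs
  set s := -((b - x) / (a - x)).re with hsdef
  have hs0 : 0 ≤ s := by linarith
  have hq : (b - x) / (a - x) = -(s : ℂ) :=
    Complex.ext (by simp [hsdef]) (by simpa using him)
  rw [div_eq_iff ha] at hq
  have h1 : (1 + s : ℂ) ≠ 0 := by exact_mod_cast (by linarith : (1 + s) ≠ 0)
  refine hx ⟨s / (1 + s), 1 / (1 + s), by positivity, by positivity, by field_simp; ring, ?_⟩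
  simp only [Complex.real_smul]
  push_cast
  field_simp
  linear_combination hq

theorem hasDerivAt_log_div {a b x : ℂ} (hx : x ∉ segment ℝ a b) :
    HasDerivAt (fun x => Complex.log ((b - x) / (a - x))) ((a - x)⁻¹ - (b - x)⁻¹) x := by
  obtain ⟨ha, hb, hs⟩ := div_mem_slitPlane hx
  have h : ∀ c : ℂ, HasDerivAt (fun x => c - x) (-1) x := fun c => by
    simpa using (hasDerivAt_id x).const_sub c
  convert ((h b).fun_div (h a) ha).clog hs using 1
  field_simp
  ring

variable {V : Type*} [Fintype V] {G K : SimpleGraph V} {γ : V → ℂ}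

/-- `2πi` times the winding number around `x` of the closed polygon drawn along a closed walk. -/
noncomputable def windingSum (γ : V → ℂ) {v : V} (p : K.Walk v v) (x : ℂ) : ℂ :=
  ∑ i, ∑ j, dartCount p i j • Complex.log ((γ j - x) / (γ i - x))

/-- The derivative of each logarithm is a difference of the vertex function `-(γ k - x)⁻¹`, so the
total telescopes around the closed walk. -/
theorem hasDerivAt_windingSum {v : V} (p : K.Walk v v) {x : ℂ}
    (hx : ∀ i j, K.Adj i j → x ∉ segment ℝ (γ i) (γ j)) :
    HasDerivAt (windingSum γ p) 0 x := by
  have h : HasDerivAt (windingSum γ p)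
      (∑ i, ∑ j, dartCount p i j • ((γ i - x)⁻¹ - (γ j - x)⁻¹)) x := by
    refine HasDerivAt.fun_sum fun i _ => HasDerivAt.fun_sum fun j _ => ?_
    by_cases h0 : dartCount p i j = 0
    · simpa [h0] using hasDerivAt_const x (0 : ℂ)
    · exact (hasDerivAt_log_div (hx i j (adj_of_dartCount_ne_zero p h0))).const_smul _
  have h0 : ∑ i, ∑ j, dartCount p i j • ((γ i - x)⁻¹ - (γ j - x)⁻¹) = 0 := by
    have := sum_darts_sub (fun k => -(γ k - x)⁻¹) p
    rw [sub_self] at this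
    rw [sum_dartCount_smul, ← this]
    congr 1
    refine List.map_congr_left fun d _ => ?_
    ring
  rwa [h0] at h

theorem windingSum_eq {v : V} (p : K.Walk v v) {U : Set ℂ} (hU : IsOpen U)
    (hU' : IsPreconnected U) (hK : ∀ x ∈ U, ∀ i j, K.Adj i j → x ∉ segment ℝ (γ i) (γ j))
    {x y : ℂ} (hx : x ∈ U) (hy : y ∈ U) : windingSum γ p x = windingSum γ p y :=
  hU.is_const_of_deriv_eq_zero hU'
    (fun z hz => (hasDerivAt_windingSum p (hK z hz)).differentiableAt.differentiableWithinAt)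
    (fun z hz => (hasDerivAt_windingSum p (hK z hz)).deriv) hx hy

theorem IsFace.windingSum_eq (hK : K ≤ G) {v : V} (p : K.Walk v v) {F : Set ℂ}
    (hF : IsFace G γ F) {x y : ℂ} (hx : x ∈ F) (hy : y ∈ F) :
    windingSum γ p x = windingSum γ p y :=
  BaryDrawing.windingSum_eq p hF.isOpen hF.isPreconnected (fun _ hz i j hij hmem =>
    hF.notMem_drawnSet hz (mem_drawnSet.2 ⟨i, j, Or.inr (hK hij), hmem⟩)) hx hy

theorem tendsto_windingSum_cobounded {v : V} (p : K.Walk v v) :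
    Tendsto (windingSum γ p) (Bornology.cobounded ℂ) (𝓝 0) := by
  have hinv : ∀ a : ℂ, Tendsto (fun x => (a - x)⁻¹) (Bornology.cobounded ℂ) (𝓝 0) := fun a =>
    tendsto_inv₀_cobounded.comp (tendsto_const_sub_cobounded a)
  have hlog : ∀ a b : ℂ, Tendsto (fun x => Complex.log ((b - x) / (a - x)))
      (Bornology.cobounded ℂ) (𝓝 0) := by
    intro a b
    have h1 : Tendsto (fun x => (b - a) * (a - x)⁻¹ + 1) (Bornology.cobounded ℂ) (𝓝 1) := by
      simpa using ((hinv a).const_mul (b - a)).add_const 1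
    have h2 : Tendsto (fun x => (b - x) / (a - x)) (Bornology.cobounded ℂ) (𝓝 1) := by
      refine h1.congr' ?_
      have : ∀ᶠ x in Bornology.cobounded ℂ, x ≠ a := by
        exact Bornology.isBounded_def.1 Bornology.isBounded_singleton
      filter_upwards [this] with x hx
      have : a - x ≠ 0 := sub_ne_zero.2 hx.symm
      field_simp
      ring
    simpa using h2.clog (by simp)
  have := tendsto_finsetSum (f := fun i x => ∑ j, dartCount p i j •
    Complex.log ((γ j - x) / (γ i - x))) (a := fun _ => (0 : ℂ)) Finset.univ fun i _ => by
    simpa using tendsto_finsetSum (f := fun j x => dartCount p i j •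
      Complex.log ((γ j - x) / (γ i - x))) (a := fun j => dartCount p i j • (0 : ℂ)) Finset.univ
        fun j _ => (hlog (γ i) (γ j)).const_smul _
  rwa [Finset.sum_const_zero] at this

/-- Each ratio tends to `1` at infinity, so the winding sum tends to `0` there; on an unbounded face
it is constant and must equal that limit. -/
theorem IsFace.windingSum_eq_zero (hK : K ≤ G) {v : V} (p : K.Walk v v) {F : Set ℂ}
    (hF : IsFace G γ F) (hFu : ¬ Bornology.IsBounded F) {x : ℂ} (hx : x ∈ F) :
    windingSum γ p x = 0 := by
  have hfr : ∃ᶠ y in Bornology.cobounded ℂ, y ∈ F := fun h => hFu (Bornology.isBounded_def.2 h)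
  have : Tendsto (fun _ : ℂ => windingSum γ p x) (Bornology.cobounded ℂ ⊓ 𝓟 F) (𝓝 0) := by
    refine ((tendsto_windingSum_cobounded (γ := γ) p).mono_left inf_le_left).congr' ?_
    exact eventually_inf_principal.2 (Eventually.of_forall fun y hy => hF.windingSum_eq hK p hy hx)
  have hne : (Bornology.cobounded ℂ ⊓ 𝓟 F).NeBot := frequently_mem_iff_neBot.1 hfr
  exact tendsto_nhds_unique tendsto_const_nhds this

/-- Seen from points approaching the midpoint of an edge, the ratio of the ends tends to `-1` from
above the branch cut on one side and from below on the other. The two limits differ by `2πi`, the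
jump of the winding sum. -/
theorem tendsto_log_neg_div :
    Tendsto (fun η : ℝ => Complex.log (-(1 / 2 - η * Complex.I) / (1 / 2 + η * Complex.I)))
      (𝓝[>] 0) (𝓝 (Real.pi * Complex.I)) ∧
    Tendsto (fun η : ℝ => Complex.log (-(1 / 2 + η * Complex.I) / (1 / 2 - η * Complex.I)))
      (𝓝[>] 0) (𝓝 (-(Real.pi * Complex.I))) := by
  have hne : ∀ η : ℝ, (1 / 2 + η * Complex.I : ℂ) ≠ 0 := fun η h => by
    have := congrArg Complex.re h; simp at this
  have hne' : ∀ η : ℝ, (1 / 2 - η * Complex.I : ℂ) ≠ 0 := fun η h => by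
    have := congrArg Complex.re h; simp at this
  have him : ∀ η : ℝ, (-(1 / 2 - η * Complex.I) / (1 / 2 + η * Complex.I)).im =
      η / (1 / 4 + η ^ 2) := by
    intro η
    have h4 : (1 / 4 + η ^ 2 : ℂ) = (1 / 2 + η * Complex.I) * (1 / 2 - η * Complex.I) := by
      linear_combination (η : ℂ) ^ 2 * Complex.I_sq
    have : (-(1 / 2 - η * Complex.I) / (1 / 2 + η * Complex.I)) =
        ((-(1 / 4 - η ^ 2) / (1 / 4 + η ^ 2) : ℝ) : ℂ) +
        ((η / (1 / 4 + η ^ 2) : ℝ) : ℂ) * Complex.I := by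
      have h1 := hne η
      have h2 := hne' η
      push_cast
      rw [h4]
      rw [div_mul_eq_mul_div, ← add_div, div_eq_div_iff h1 (mul_ne_zero h1 h2)]
      linear_combination (-(η : ℂ) ^ 2 * (1 / 2 + η * Complex.I)) * Complex.I_sq
    rw [this, Complex.add_im, Complex.ofReal_im, Complex.im_ofReal_mul, Complex.I_im]
    ring
  have him' : ∀ η : ℝ, (-(1 / 2 + η * Complex.I) / (1 / 2 - η * Complex.I)).im =
      -η / (1 / 4 + η ^ 2) := by
    intro η
    have := him (-η)
    simpa [sub_eq_add_neg] using this
  have hden : ∀ η : ℝ, 0 < 1 / 4 + η ^ 2 := fun η => by positivity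
  have hlog1 : (Real.log ‖(-1 : ℂ)‖ : ℂ) = 0 := by simp
  constructor
  · have h := Complex.tendsto_log_nhdsWithin_im_nonneg_of_re_neg_of_im_zero (z := -1) (by simp)
      (by simp)
    rw [hlog1, zero_add] at h
    refine h.comp (tendsto_nhdsWithin_iff.2 ⟨?_, ?_⟩)
    · have : ContinuousAt (fun η : ℝ => -(1 / 2 - η * Complex.I) / (1 / 2 + η * Complex.I)) 0 :=
        ContinuousAt.div (by fun_prop) (by fun_prop) (hne 0)
      have h1 := this.tendsto.mono_left (nhdsWithin_le_nhds (s := Set.Ioi 0))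
      simpa using h1
    · filter_upwards [self_mem_nhdsWithin] with η hη
      have := div_pos hη (hden η)
      show 0 ≤ Complex.im _
      rw [him]
      exact this.le
  · have h := Complex.tendsto_log_nhdsWithin_im_neg_of_re_neg_of_im_zero (z := -1) (by simp)
      (by simp)
    rw [hlog1, zero_sub] at h
    refine h.comp (tendsto_nhdsWithin_iff.2 ⟨?_, ?_⟩)
    · have : ContinuousAt (fun η : ℝ => -(1 / 2 + η * Complex.I) / (1 / 2 - η * Complex.I)) 0 :=
        ContinuousAt.div (by fun_prop) (by fun_prop) (hne' 0)
      have h1 := this.tendsto.mono_left (nhdsWithin_le_nhds (s := Set.Ioi 0))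
      simpa using h1
    · filter_upwards [self_mem_nhdsWithin] with η hη
      have := div_pos hη (hden η)
      show Complex.im _ < 0
      rw [him', neg_div]
      linarith

/-- The winding number jumps across an edge by the net number of traversals of that edge. -/
theorem IsPlanarDrawing.windingSum_sub (hγ : IsPlanarDrawing G γ) (hK : K ≤ G) {v : V}
    (p : K.Walk v v) {i j : V} (hij : G.Adj i j) {x y : ℂ} (hx : x ∈ leftFace G γ i j)
    (hy : y ∈ leftFace G γ j i) :
    windingSum γ p x - windingSum γ p y =
      (dartCount p i j - dartCount p j i) * (2 * Real.pi * Complex.I) := by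
  classical
  obtain ⟨hL, ε, hε, hεF⟩ := hγ.isLeftFace_leftFace hij
  obtain ⟨hR, ε', hε', hεF'⟩ := hγ.isLeftFace_leftFace hij.symm
  have hd := hγ.sub_ne_zero hij.ne
  set d := γ j - γ i with hd_def
  set P : ℝ → ℂ := fun η => γ i + (1 / 2 + η * Complex.I) * d with hP
  set Q : ℝ → ℂ := fun η => γ i + (1 / 2 - η * Complex.I) * d with hQ
  have hP0 : P 0 = γ i + (1 / 2) * d := by simp [hP]
  have hQ0 : Q 0 = γ i + (1 / 2) * d := by simp [hQ]
  have hPc : Tendsto P (𝓝[>] 0) (𝓝 (γ i + (1 / 2) * d)) := by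
    have : Continuous P := by fun_prop
    rw [← hP0]
    exact (this.tendsto 0).mono_left nhdsWithin_le_nhds
  have hQc : Tendsto Q (𝓝[>] 0) (𝓝 (γ i + (1 / 2) * d)) := by
    have : Continuous Q := by fun_prop
    rw [← hQ0]
    exact (this.tendsto 0).mono_left nhdsWithin_le_nhds
  have hmid : γ i + (1 / 2) * d ∈ segment ℝ (γ i) (γ j) := by
    refine ⟨1 / 2, 1 / 2, by norm_num, by norm_num, by norm_num, ?_⟩
    simp only [Complex.real_smul, hd_def]
    push_cast
    ring
  have hγij : γ j = γ i + d := by rw [hd_def]; ring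
  have hne : ∀ η : ℝ, (1 / 2 + η * Complex.I : ℂ) ≠ 0 := fun η h => by
    have := congrArg Complex.re h; simp at this
  have hne' : ∀ η : ℝ, (1 / 2 - η * Complex.I : ℂ) ≠ 0 := fun η h => by
    have := congrArg Complex.re h; simp at this
  have hij1 : ∀ η, (γ j - P η) / (γ i - P η) =
      -(1 / 2 - η * Complex.I) / (1 / 2 + η * Complex.I) := by
    intro η
    have h1 := hne η
    have h2 : γ i - P η ≠ 0 := by
      simp only [hP, sub_add_cancel_left]
      exact neg_ne_zero.2 (mul_ne_zero h1 hd)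
    rw [hγij, div_eq_div_iff h2 h1]
    simp only [hP]
    ring
  have hij2 : ∀ η, (γ j - Q η) / (γ i - Q η) =
      -(1 / 2 + η * Complex.I) / (1 / 2 - η * Complex.I) := by
    intro η
    have h1 := hne' η
    have h2 : γ i - Q η ≠ 0 := by
      simp only [hQ, sub_add_cancel_left]
      exact neg_ne_zero.2 (mul_ne_zero h1 hd)
    rw [hγij, div_eq_div_iff h2 h1]
    simp only [hQ]
    ring
  have hswap : ∀ a b : ℂ, (-a / b)⁻¹ = -b / a := fun a b => by rw [inv_div, div_neg, neg_div]
  have hji1 : ∀ η, (γ i - P η) / (γ j - P η) =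
      -(1 / 2 + η * Complex.I) / (1 / 2 - η * Complex.I) := fun η => by
    rw [← inv_div, hij1, hswap]
  have hji2 : ∀ η, (γ i - Q η) / (γ j - Q η) =
      -(1 / 2 - η * Complex.I) / (1 / 2 + η * Complex.I) := fun η => by
    rw [← inv_div, hij2, hswap]
  obtain ⟨hlog, hlog'⟩ := tendsto_log_neg_div
  set c : ℂ := 2 * Real.pi * Complex.I with hc
  -- `P` and `Q` approach the midpoint from the left and from the right. Only the two darts on this
  -- edge see a jump; the other logarithms are continuous at the midpoint.
  have hterm : ∀ k l, Tendsto (fun η : ℝ =>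
      dartCount p k l • Complex.log ((γ l - P η) / (γ k - P η)) -
      dartCount p k l • Complex.log ((γ l - Q η) / (γ k - Q η))) (𝓝[>] 0)
      (𝓝 (dartCount p k l • ((if k = i ∧ l = j then c else 0) -
        (if k = j ∧ l = i then c else 0)))) := by
    intro k l
    simp only [← smul_sub]
    by_cases h0 : dartCount p k l = 0
    · simp [h0]
    refine Tendsto.const_smul ?_ _
    by_cases h1 : k = i ∧ l = j
    · obtain ⟨rfl, rfl⟩ := h1
      have h2 : ¬ (k = l ∧ l = k) := fun h => hij.ne h.1
      simp only [hij1, hij2, and_self, if_true, if_neg h2]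
      convert hlog.sub hlog' using 2
      rw [hc]; ring
    by_cases h2 : k = j ∧ l = i
    · obtain ⟨rfl, rfl⟩ := h2
      simp only [hji1, hji2, and_self, if_true, if_neg h1]
      convert hlog'.sub hlog using 2
      rw [hc]; ring
    rw [if_neg h1, if_neg h2]
    have hkl := hK (adj_of_dartCount_ne_zero p h0)
    have hm : γ i + (1 / 2) * d ∉ segment ℝ (γ k) (γ l) := by
      intro hm
      have hs : s(i, j) ≠ s(k, l) := by
        intro h
        rcases Sym2.eq_iff.1 h with ⟨rfl, rfl⟩ | ⟨rfl, rfl⟩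
        · exact h1 ⟨rfl, rfl⟩
        · exact h2 ⟨rfl, rfl⟩
      obtain ⟨u, hu, -, hpu⟩ := hγ.edge_inter i j k l hij hkl hs _ hmid hm
      rw [Sym2.mem_iff] at hu
      rcases hu with rfl | rfl
      · apply hd; linear_combination 2 * hpu
      · apply hd; rw [hγij] at hpu; linear_combination -2 * hpu
    have hcont := (hasDerivAt_log_div hm).continuousAt.tendsto
    simpa using (hcont.comp hPc).sub (hcont.comp hQc)
  have hsum : Tendsto (fun η : ℝ => windingSum γ p (P η) - windingSum γ p (Q η)) (𝓝[>] 0)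
      (𝓝 ((dartCount p i j - dartCount p j i) * c)) := by
    have := tendsto_finsetSum Finset.univ fun k _ =>
      tendsto_finsetSum Finset.univ fun l _ => hterm k l
    convert this using 2
    · simp only [windingSum, Finset.sum_sub_distrib]
    · have hpick : ∀ a b : V, ∑ k, ∑ l, dartCount p k l • (if k = a ∧ l = b then c else 0) =
          dartCount p a b • c := by
        intro a b
        rw [Finset.sum_eq_single a, Finset.sum_eq_single b] <;> simp +contextual
      simp only [smul_sub, Finset.sum_sub_distrib]
      rw [hpick, hpick, nsmul_eq_mul, nsmul_eq_mul]
      ring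
  refine tendsto_nhds_unique (tendsto_const_nhds.congr' ?_) hsum
  filter_upwards [eventually_add_mul_I_mem_thinTriangle hε (x := 1 / 2) (by norm_num) (by norm_num),
    eventually_add_mul_I_mem_thinTriangle hε' (x := 1 / 2) (by norm_num) (by norm_num)]
    with η h1 h2
  have h3 : P η ∈ leftFace G γ i j := by
    convert hεF _ h1 using 1
    simp [hP]
  have h4 : Q η ∈ leftFace G γ j i := by
    convert hεF' _ h2 using 1
    simp only [hQ, hd_def]
    push_cast
    ring
  rw [hL.windingSum_eq hK p hx h3, hR.windingSum_eq hK p hy h4]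

/-- A closed walk through internal vertices has winding number zero around the points of a face
incident to an external vertex. -/
theorem IsPlanarDrawing.windingSum_eq_zero (hγ : IsPlanarDrawing G γ) (hK : K ≤ G)
    (hint : ∀ i j, K.Adj i j → IsInternal G γ i) {v : V} (p : K.Walk v v) {F : Set ℂ}
    (hF : IsFace G γ F) (hFi : ¬ IsStrictlyInternalFace G γ F) {x : ℂ} (hx : x ∈ F) :
    windingSum γ p x = 0 := by
  obtain ⟨u, huF, hu⟩ : ∃ u, Incident γ u F ∧ IsExternal G γ u := by
    by_contra! h
    exact hFi ⟨hF, h⟩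
  obtain ⟨F₀, ⟨hF₀, hunb⟩, huF₀⟩ := hu
  have hseg : ∀ k l, K.Adj k l → γ u ∉ segment ℝ (γ k) (γ l) := by
    intro k l hkl hmem
    rcases hγ.vertex_on_edge _ _ _ (hK hkl) hmem with rfl | rfl
    · exact hint _ _ hkl ⟨F₀, ⟨hF₀, hunb⟩, huF₀⟩
    · exact hint _ _ hkl.symm ⟨F₀, ⟨hF₀, hunb⟩, huF₀⟩
  have hev : ∀ᶠ q in 𝓝 (γ u), ∀ k l, K.Adj k l → q ∉ segment ℝ (γ k) (γ l) :=
    eventually_all.2 fun k => eventually_all.2 fun l => eventually_all.2 fun h =>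
      (isCompact_segment _ _).isClosed.isOpen_compl.mem_nhds (hseg k l h)
  obtain ⟨δ, hδ, hball⟩ := Metric.eventually_nhds_iff_ball.1 hev
  obtain ⟨a, haF, ha⟩ := Metric.mem_closure_iff.1 (frontier_subset_closure huF) δ hδ
  obtain ⟨b, hbF, hb⟩ := Metric.mem_closure_iff.1 (frontier_subset_closure huF₀) δ hδ
  -- A ball around `γ u` that misses the edges of `K` links `F` to the unbounded face.
  rw [hF.windingSum_eq hK p hx haF, BaryDrawing.windingSum_eq p Metric.isOpen_ball
    (convex_ball (γ u) δ).isPreconnected hball (Metric.mem_ball'.2 ha) (Metric.mem_ball'.2 hb),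
    hF₀.windingSum_eq_zero hK p hunb hbF]

end Winding

end BaryDrawing

namespace BaryDrawing

/-! ### The cycle equation for normalised symmetric weights -/

section CycleEquation

variable {V : Type*} {G : SimpleGraph V} {γ : V → ℂ}

theorem prod_darts_fst_eq_prod_darts_snd (S : V → ℝ) {u v : V} (p : G.Walk u v) :
    (p.darts.map fun d => S d.fst).prod * S v = S u * (p.darts.map fun d => S d.snd).prod := by
  induction p with
  | nil => simp
  | cons h p ih =>
    simp only [SimpleGraph.Walk.darts_cons, List.map_cons, List.prod_cons]
    rw [mul_assoc, ih]

theorem cycleEquation_of_div (w : Sym2 V → ℝ) {S : V → ℝ} (hS : ∀ i, S i ≠ 0) {v : V}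
    (p : G.Walk v v) : CycleEquation (fun i j => w s(i, j) / S i) p := by
  have h := prod_darts_fst_eq_prod_darts_snd (fun i => (S i)⁻¹) p
  rw [mul_comm] at h
  have h' := mul_left_cancel₀ (inv_ne_zero (hS v)) h
  simp only [CycleEquation, div_eq_mul_inv, List.prod_map_mul, h', Sym2.eq_swap]

/-- Strict internality alone could hold vacuously; a facial cycle supplies an incident vertex. -/
theorem IsStrictlyInternalFace.isInternalFace {F : Set ℂ} (hF : IsStrictlyInternalFace G γ F)
    {v : V} {c : G.Walk v v} (hc : IsFacialCycle γ F c) : IsInternalFace G γ F := by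
  obtain ⟨hcyc, hseg⟩ := hc
  cases c with
  | nil => exact absurd rfl hcyc.ne_nil
  | cons h p =>
    have hv : Incident γ v F := hseg ⟨(_, _), h⟩ (by simp) (left_mem_segment _ _ _)
    exact ⟨hF.1, v, hv, hF.2 v hv⟩

end CycleEquation

/-! ### From face equations to symmetric weights -/

section Main

variable {V : Type*} [Fintype V] {G : SimpleGraph V} {γ : V → ℂ}

/-- Every cycle in the graph of edges drawn in `frontier F` is facial by definition, so `c` has a
potential there. A potential difference pairs to zero with a balanced flow, and it does not matter
whether the boundary of `F` is a single cycle. -/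
theorem IsPlanarDrawing.sum_mul_eq_zero_of_isFacialCycle (hγ : IsPlanarDrawing G γ) {F : Set ℂ}
    {c : V → V → ℝ} (hc : ∀ i j, c j i = -c i j)
    (hcyc : ∀ (v : V) (p : G.Walk v v), IsFacialCycle γ F p →
      (p.darts.map fun d => c d.fst d.snd).sum = 0)
    {e : V → V → ℝ} (he : ∀ i j, e i j ≠ 0 → G.Adj i j ∧ leftFace G γ i j = F)
    (hbal : ∀ i, ∑ j, (e i j - e j i) = 0) : ∑ i, ∑ j, c i j * e i j = 0 := by
  let K : SimpleGraph V :=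
    { Adj := fun i j => G.Adj i j ∧ segment ℝ (γ i) (γ j) ⊆ frontier F
      symm := ⟨fun i j h => ⟨h.1.symm, by rw [segment_symm]; exact h.2⟩⟩
      loopless := ⟨fun i h => G.loopless.irrefl i h.1⟩ }
  have hKG : K ≤ G := fun i j h => h.1
  obtain ⟨φ, hφ⟩ := exists_potential K c hc fun v p hp => by
    rw [← darts_mapLe_sum hKG]
    refine hcyc v _ ⟨hp.mapLe hKG, fun d hd => ?_⟩
    rw [SimpleGraph.Walk.mapLe, SimpleGraph.Walk.darts_map] at hd
    obtain ⟨d', -, rfl⟩ := List.mem_map.1 hd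
    exact d'.adj.2
  have h1 : ∀ i j, c i j * e i j = φ j * e i j - φ i * e i j := by
    intro i j
    by_cases h : e i j = 0
    · simp [h]
    · obtain ⟨hij, hL⟩ := he i j h
      have hK : K.Adj i j :=
        ⟨hij, hL ▸ (hγ.isLeftFace_leftFace hij).segment_subset_frontier hij⟩
      rw [hφ i j hK]
      ring
  simp only [h1, Finset.sum_sub_distrib]
  rw [Finset.sum_comm, ← Finset.sum_sub_distrib]
  refine Finset.sum_eq_zero fun i _ => ?_
  have := hbal i
  rw [Finset.sum_sub_distrib] at this
  rw [← Finset.mul_sum, ← Finset.mul_sum, ← mul_sub]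
  exact mul_eq_zero_of_right _ (by linarith)

/-- If an antisymmetric function on the darts sums to zero over the boundary cycle of every
strictly internal face, it sums to zero over every closed walk through internal vertices. -/
theorem IsPlanarDrawing.sum_darts_eq_zero (hγ : IsPlanarDrawing G γ) {K : SimpleGraph V}
    (hK : K ≤ G) (hint : ∀ i j, K.Adj i j → IsInternal G γ i) {c : V → V → ℝ}
    (hc : ∀ i j, c j i = -c i j)
    (hcyc : ∀ F, IsStrictlyInternalFace G γ F → ∀ (v : V) (p : G.Walk v v), IsFacialCycle γ F p →
      (p.darts.map fun d => c d.fst d.snd).sum = 0) {v : V} (p : K.Walk v v) :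
    (p.darts.map fun d => c d.fst d.snd).sum = 0 := by
  classical
  set w : Set ℂ → ℝ := fun F =>
    if h : F.Nonempty then (windingSum γ p h.some / (2 * Real.pi * Complex.I)).re else 0 with hw
  set e : V → V → Set ℂ → ℝ := fun i j F => if G.Adj i j ∧ leftFace G γ i j = F then 1 else 0
    with he
  set faces : Finset (Set ℂ) :=
    Finset.univ.image fun q : V × V => leftFace G γ q.1 q.2 with hfaces
  have hmem : ∀ i j, leftFace G γ i j ∈ faces := fun i j =>
    Finset.mem_image.2 ⟨(i, j), Finset.mem_univ _, rfl⟩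
  have hpi : (2 * Real.pi * Complex.I : ℂ) ≠ 0 := by
    simp [Real.pi_ne_zero]
  have hflow : ∀ i j, (dartCount p i j : ℝ) - dartCount p j i =
      ∑ F ∈ faces, (e i j F - e j i F) * w F := by
    intro i j
    by_cases hij : G.Adj i j
    · have hne : ∀ {i j}, G.Adj i j → (leftFace G γ i j).Nonempty := fun {i j} hij => by
        obtain ⟨-, ε, hε, h⟩ := hγ.isLeftFace_leftFace hij
        obtain ⟨z, hz⟩ := thinTriangle_nonempty hε
        exact ⟨_, h z hz⟩
      have hs : ∀ {i j}, G.Adj i j → ∑ F ∈ faces, e i j F * w F = w (leftFace G γ i j) := by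
        intro i j hij
        simp only [he, hij, true_and, ite_mul, one_mul, zero_mul]
        rw [Finset.sum_ite_eq, if_pos (hmem i j)]
      simp only [sub_mul, Finset.sum_sub_distrib]
      rw [hs hij, hs hij.symm]
      simp only [hw, dif_pos (hne hij), dif_pos (hne hij.symm)]
      rw [← Complex.sub_re, ← sub_div, hγ.windingSum_sub hK p hij (hne hij).some_mem
        (hne hij.symm).some_mem, mul_div_cancel_right₀ _ hpi]
      simp
    · have h0 : ∀ {i j}, ¬ G.Adj i j → dartCount p i j = 0 := fun {i j} hij => by
        by_contra h
        exact hij (hK (adj_of_dartCount_ne_zero p h))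
      have hji : ¬ G.Adj j i := fun h => hij h.symm
      simp [h0 hij, h0 hji, he, hij, hji]
  -- For a strictly internal face the boundary sum vanishes, for any other face the winding number
  -- does, and a set that is not a face is left of no dart.
  have hface : ∀ F, w F * ∑ i, ∑ j, c i j * e i j F = 0 := by
    intro F
    by_cases hw0 : w F = 0
    · rw [hw0, zero_mul]
    by_cases hF : IsFace G γ F
    swap
    · rw [Finset.sum_eq_zero, mul_zero]
      refine fun i _ => Finset.sum_eq_zero fun j _ => ?_
      have : ¬ (G.Adj i j ∧ leftFace G γ i j = F) := fun h =>
        hF (h.2 ▸ (hγ.isLeftFace_leftFace h.1).1)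
      simp [he, this]
    by_cases hFi : IsStrictlyInternalFace G γ F
    swap
    · refine absurd ?_ hw0
      simp only [hw]
      split_ifs with h
      · rw [hγ.windingSum_eq_zero hK hint p hF hFi h.some_mem]
        simp
      · rfl
    refine mul_eq_zero_of_right _ (hγ.sum_mul_eq_zero_of_isFacialCycle hc (hcyc F hFi)
      (fun i j h => by by_contra h'; exact h (if_neg h')) fun i => ?_)
    rw [← hγ.sum_leftFace_sub i hF]
    refine (Finset.sum_subset (Finset.subset_univ _) fun j _ hj => ?_).symm.trans
      (Finset.sum_congr rfl fun j hj => ?_)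
    · rw [SimpleGraph.mem_neighborFinset] at hj
      have hj' : ¬ G.Adj j i := fun h => hj h.symm
      simp [he, hj, hj']
    · rw [SimpleGraph.mem_neighborFinset] at hj
      simp [he, hj, hj.symm]
  have hS : ∑ i, ∑ j, (dartCount p i j : ℝ) * c i j =
      (p.darts.map fun d => c d.fst d.snd).sum := by
    simpa only [nsmul_eq_mul] using sum_dartCount_smul p c
  have hS' : ∑ i, ∑ j, (dartCount p j i : ℝ) * c i j =
      -(p.darts.map fun d => c d.fst d.snd).sum := by
    rw [Finset.sum_comm, ← hS, ← Finset.sum_neg_distrib]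
    refine Finset.sum_congr rfl fun i _ => ?_
    rw [← Finset.sum_neg_distrib]
    exact Finset.sum_congr rfl fun j _ => by rw [hc i j, mul_neg]
  have hanti : ∀ F, ∑ i, ∑ j, c i j * e j i F = -∑ i, ∑ j, c i j * e i j F := by
    intro F
    rw [Finset.sum_comm, ← Finset.sum_neg_distrib]
    refine Finset.sum_congr rfl fun i _ => ?_
    rw [← Finset.sum_neg_distrib]
    exact Finset.sum_congr rfl fun j _ => by rw [hc i j, neg_mul]
  -- Antisymmetry makes both orientations contribute equally, so this is twice the sum of `c` along
  -- `p`.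
  have htot : ∑ i, ∑ j, ((dartCount p i j : ℝ) - dartCount p j i) * c i j = 0 := by
    calc ∑ i, ∑ j, ((dartCount p i j : ℝ) - dartCount p j i) * c i j
        = ∑ F ∈ faces, ∑ i, ∑ j, (e i j F - e j i F) * w F * c i j := by
          simp only [hflow, Finset.sum_mul]
          refine (Finset.sum_congr rfl fun i _ => Finset.sum_comm).trans Finset.sum_comm
      _ = 0 := by
          refine Finset.sum_eq_zero fun F _ => ?_
          have h1 : ∑ i, ∑ j, (e i j F - e j i F) * w F * c i j =
              w F * (∑ i, ∑ j, c i j * e i j F - ∑ i, ∑ j, c i j * e j i F) := by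
            rw [← Finset.sum_sub_distrib, Finset.mul_sum]
            refine Finset.sum_congr rfl fun i _ => ?_
            rw [← Finset.sum_sub_distrib, Finset.mul_sum]
            exact Finset.sum_congr rfl fun j _ => by ring
          rw [h1, hanti, sub_neg_eq_add, mul_add, hface, add_zero]
  simp only [sub_mul, Finset.sum_sub_distrib] at htot
  linarith

-- The potential is sought only on edges between internal vertices: on an edge with one external
-- end, `z` from the internal end alone fixes the weight, so symmetry imposes nothing. Scaling by
-- `exp (φ i)` preserves the barycenter equation at `i`.
open scoped Classical in
theorem isWeightedBarycenterDrawing_of_cycleEquation (hγ : IsPlanarDrawing G γ) {z : V → V → ℝ}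
    (hz : IsConvexWeights G γ z)
    (hcyc : ∀ F : Set ℂ, IsStrictlyInternalFace G γ F →
      ∀ (v : V) (c : G.Walk v v), IsFacialCycle γ F c → CycleEquation z c) :
    IsWeightedBarycenterDrawing G γ := by
  let K : SimpleGraph V :=
    { Adj := fun i j => G.Adj i j ∧ IsInternal G γ i ∧ IsInternal G γ j
      symm := ⟨fun i j h => ⟨h.1.symm, h.2.2, h.2.1⟩⟩
      loopless := ⟨fun i h => G.loopless.irrefl i h.1⟩ }
  have hKG : K ≤ G := fun i j h => h.1
  set c : V → V → ℝ := fun i j => Real.log (z i j) - Real.log (z j i) with hc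
  have hanti : ∀ i j, c j i = -c i j := fun i j => by simp only [hc]; ring
  obtain ⟨φ, hφ⟩ := exists_potential K c hanti fun v p _ =>
    hγ.sum_darts_eq_zero hKG (fun i j h => h.2.1) hanti (fun F hF v p hp => by
      have hpos : ∀ d ∈ p.darts, 0 < z d.fst d.snd ∧ 0 < z d.snd d.fst := fun d hd =>
        ⟨(hz _ (hF.2 _ (hp.2 d hd (left_mem_segment _ _ _)))).1 _ d.adj,
          (hz _ (hF.2 _ (hp.2 d hd (right_mem_segment _ _ _)))).1 _ d.adj.symm⟩
      -- The logarithm of the cycle equation says that `c` sums to zero; all factors are positive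
      -- because the vertices of the cycle are incident to `F`, hence internal.
      have heq := congrArg Real.log (hcyc F hF v p hp)
      rw [Real.log_list_prod, Real.log_list_prod, List.map_map, List.map_map] at heq
      · simp only [hc]
        have h := List.sum_map_add (l := p.darts)
          (f := fun d => Real.log (z d.fst d.snd) - Real.log (z d.snd d.fst))
          (g := fun d => Real.log (z d.snd d.fst))
        simp only [sub_add_cancel] at h
        exact add_eq_right.1 (h.symm.trans heq)
      · intro x hx
        obtain ⟨d, hd, rfl⟩ := List.mem_map.1 hx
        exact (hpos d hd).2.ne'
      · intro x hx
        obtain ⟨d, hd, rfl⟩ := List.mem_map.1 hx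
        exact (hpos d hd).1.ne') p
  have hsym : ∀ i j, G.Adj i j → IsInternal G γ i → IsInternal G γ j →
      Real.exp (φ i) * z i j = Real.exp (φ j) * z j i := by
    intro i j hij hi hj
    have h := hφ i j ⟨hij, hi, hj⟩
    have h1 := (hz i hi).1 j hij
    have h2 := (hz j hj).1 i hij.symm
    rw [← Real.exp_log h1, ← Real.exp_log h2, ← Real.exp_add, ← Real.exp_add]
    congr 1
    simp only [hc] at h
    linarith
  -- The weight is read off at an internal end of the edge; when both ends are internal, `hsym`
  -- makes the two readings agree.
  set w₀ : V → V → ℝ := fun i j => if G.Adj i j ∧ IsInternal G γ i then Real.exp (φ i) * z i j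
    else if G.Adj j i ∧ IsInternal G γ j then Real.exp (φ j) * z j i else 0 with hw₀
  have hw₀s : ∀ i j, w₀ i j = w₀ j i := by
    intro i j
    simp only [hw₀]
    split_ifs with h1 h2
    · exact hsym i j h1.1 h1.2 h2.2
    all_goals rfl
  have hw : ∀ i j, G.Adj i j → IsInternal G γ i →
      Sym2.lift ⟨w₀, hw₀s⟩ s(i, j) = Real.exp (φ i) * z i j := by
    intro i j hij hi
    rw [Sym2.lift_mk]
    exact if_pos ⟨hij, hi⟩
  refine ⟨Sym2.lift ⟨w₀, hw₀s⟩, fun i j hij hi => ?_, fun i hi => ?_⟩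
  · rw [hw i j hij hi]
    exact mul_pos (Real.exp_pos _) ((hz i hi).1 j hij)
  · obtain ⟨-, h1, h2⟩ := hz i hi
    have hs : ∑ j ∈ G.neighborFinset i, Sym2.lift ⟨w₀, hw₀s⟩ s(i, j) = Real.exp (φ i) := by
      rw [Finset.sum_congr rfl fun j hj => hw i j ((G.mem_neighborFinset i j).1 hj) hi,
        ← Finset.mul_sum, h1, mul_one]
    rw [hs, Finset.sum_congr rfl fun j hj => by
      rw [hw i j ((G.mem_neighborFinset i j).1 hj) hi, mul_smul], ← Finset.smul_sum, ← h2, smul_smul,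
      inv_mul_cancel₀ (Real.exp_ne_zero _), one_smul]

open scoped Classical in
/-- Symmetric weights give normalised weights that are positive on all darts and satisfy the
cycle equation for every closed walk. -/
theorem IsWeightedBarycenterDrawing.exists_convexWeights (hG : ∀ i, ∃ j, G.Adj i j)
    (h : IsWeightedBarycenterDrawing G γ) :
    ∃ z : V → V → ℝ, IsConvexWeights G γ z ∧ (∀ i j : V, G.Adj i j → 0 < z i j) ∧
      ∀ (v : V) (c : G.Walk v v), CycleEquation z c := by
  obtain ⟨w, hw, hbar⟩ := h
  -- The given weights may fail to be positive off the internal edges. The value `1` there makes `z`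
  -- positive on all darts without affecting internal vertices.
  set w' : Sym2 V → ℝ := fun q => if 0 < w q then w q else 1 with hw'
  have hpos : ∀ q, 0 < w' q := by
    intro q
    simp only [hw']
    split_ifs with h
    · exact h
    · exact one_pos
  have hww : ∀ i j, G.Adj i j → IsInternal G γ i → w' s(i, j) = w s(i, j) := fun i j hij hi =>
    if_pos (hw i j hij hi)
  set S : V → ℝ := fun i => ∑ j ∈ G.neighborFinset i, w' s(i, j) with hS
  have hSpos : ∀ i, 0 < S i := fun i =>
    Finset.sum_pos (fun j _ => hpos _)
      (let ⟨j, hj⟩ := hG i; ⟨j, (G.mem_neighborFinset i j).2 hj⟩)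
  refine ⟨fun i j => w' s(i, j) / S i, fun i hi => ⟨fun j _ => div_pos (hpos _) (hSpos i), ?_, ?_⟩,
    fun i j _ => div_pos (hpos _) (hSpos i),
    fun v c => cycleEquation_of_div w' (fun i => (hSpos i).ne') c⟩
  · rw [← Finset.sum_div, div_self (hSpos i).ne']
  · have hmem : ∀ j ∈ G.neighborFinset i, w s(i, j) = w' s(i, j) := fun j hj =>
      (hww i j ((G.mem_neighborFinset i j).1 hj) hi).symm
    refine (hbar i hi).trans ?_
    have hsum : ∑ j ∈ G.neighborFinset i, w s(i, j) • γ j =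
        ∑ j ∈ G.neighborFinset i, w' s(i, j) • γ j :=
      Finset.sum_congr rfl fun j hj => by rw [hmem j hj]
    rw [Finset.sum_congr rfl hmem, hsum, Finset.smul_sum]
    exact Finset.sum_congr rfl fun j _ => by
      simp only [smul_smul, div_eq_inv_mul, hS]

/-- Connectedness with nothing deleted suffices; a neighbour at each vertex makes the normalising
sums nonzero, at external vertices too. -/
theorem Triconnected.exists_adj (hG : Triconnected G) (i : V) : ∃ j, G.Adj i j := by
  obtain ⟨hcard, hconn⟩ := hG
  have hnt : Nontrivial V := Fintype.one_lt_card_iff_nontrivial.1 (by omega)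
  have h := hconn ∅ (by simp)
  obtain ⟨j, hj⟩ := exists_ne i
  obtain ⟨p⟩ := h.preconnected ⟨i, by simp⟩ ⟨j, by simp⟩
  cases p with
  | nil => exact absurd rfl hj
  | cons h _ => exact ⟨_, h⟩

end Main

end BaryDrawing

theorem mainTheorem2 {V : Type*} [Fintype V] (G : SimpleGraph V) (γ : V → ℂ)
    (hG : BaryDrawing.Triconnected G) (hγ : BaryDrawing.IsPlanarDrawing G γ)
    (hout : BaryDrawing.HullIsOuterFace G γ) :
    (BaryDrawing.IsWeightedBarycenterDrawing G γ ↔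
      ∃ z : V → V → ℝ, BaryDrawing.IsConvexWeights G γ z ∧
        ∀ F : Set ℂ, BaryDrawing.IsStrictlyInternalFace G γ F →
          ∀ (v : V) (c : G.Walk v v), BaryDrawing.IsFacialCycle γ F c →
            BaryDrawing.CycleEquation z c) ∧
    (BaryDrawing.IsWeightedBarycenterDrawing G γ ↔
      ∃ z : V → V → ℝ, BaryDrawing.IsConvexWeights G γ z ∧
        (∀ i j : V, G.Adj i j → 0 < z i j) ∧
        ∀ F : Set ℂ, BaryDrawing.IsInternalFace G γ F →
          ∀ (v : V) (c : G.Walk v v), BaryDrawing.IsFacialCycle γ F c →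
            BaryDrawing.CycleEquation z c) := by
  have hforward := BaryDrawing.IsWeightedBarycenterDrawing.exists_convexWeights (γ := γ)
    hG.exists_adj
  refine ⟨⟨fun h => ?_, fun ⟨z, hz, hcyc⟩ => ?_⟩, ⟨fun h => ?_, fun ⟨z, hz, _, hcyc⟩ => ?_⟩⟩
  · obtain ⟨z, hz, -, hcyc⟩ := hforward h
    exact ⟨z, hz, fun F _ v c _ => hcyc v c⟩
  · exact BaryDrawing.isWeightedBarycenterDrawing_of_cycleEquation hγ hz hcyc
  · obtain ⟨z, hz, hpos, hcyc⟩ := hforward h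
    exact ⟨z, hz, hpos, fun F _ v c _ => hcyc v c⟩
  · exact BaryDrawing.isWeightedBarycenterDrawing_of_cycleEquation hγ hz fun F hF v c hc =>
      hcyc F (hF.isInternalFace hc) v c hc
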